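/- Let $F|k$ be an extension of algebraically closed fields of characteristic zero whose transcendence degree $n$ is at least $1$ and is finite or countably infinite. Let $G=\mathrm{Aut}(F|k)$ be the group of all automorphisms of $F$ over $k$, with the topology whose base of open subgroups is formed by the pointwise stabilizers of the finite subsets of $F$. Let $\mathcal P^1_F$ be the set of discrete valuations of $F$ of rank one, trivial on $k$, i.e. of the valuation rings $\mathcal O_v\subset F$ such that: (i) $k\subseteq\mathcal O_v$; (ii) the valuation group $\Gamma=F^\times/\mathcal O_v^\times$, which is a $\mathbb Q$-vector space, has dimension $1$ over $\mathbb Q$; (iii) there are a lift $X\subseteq\mathcal O_v$ of some transcendence basis over $k$ of the residue field of $\mathcal O_v$ and an element $t\in F^\times$ with non-zero class in $\Gamma$ such that $F$ is algebraic over $k(X,t)$. For $v\in\mathcal P^1_F$ let $G_v=\{\sigma\in G : \sigma(\mathcal O_v)=\mathcal O_v\}$. (1) Let $v,v'\in\mathcal P^1_F$ be distinct and let $H$ be the subgroup of $G$ generated by $G_v$ and $G_{v'}$. Then for every finitely generated field extension $L|k$ the group $H$ acts transitively on the set of $k$-embeddings $L\hookrightarrow F$, i.e. for any two $k$-embeddings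 $\xi,\eta:L\hookrightarrow F$ there is $\sigma\in H$ with $\sigma\xi=\eta$. Moreover, $H$ is dense in $G$. (2) For every $v\in\mathcal P^1_F$ the subgroup $G_v$ of $G$ is closed and not open, and it is maximal among the proper closed subgroups of $G$. -/

import Mathlib

open scoped Topology

/-- The topology on the group `G = Aut(F|k)` of all automorphisms of `F` over `k` whose base of open
subgroups is given by the pointwise stabilizers of finite subsets of `F`: a set is open iff with each
`σ` it contains, for some finite `S ⊆ F`, every `τ` that agrees with `σ` on `S`, i.e. the coset
`σ · Stab(S)`. (Mathlib's `krullTopology` only uses stabilizers of subfields finite over `k`; it is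
indiscrete when `k` is algebraically closed, and is not used here.) -/
@[reducible] def autTopology (k F : Type*) [Field k] [Field F] [Algebra k F] :
    TopologicalSpace (F ≃ₐ[k] F) where
  IsOpen U := ∀ σ ∈ U, ∃ S : Finset F, ∀ τ : F ≃ₐ[k] F, (∀ x ∈ S, τ x = σ x) → τ ∈ U
  isOpen_univ := fun _ _ => ⟨∅, fun _ _ => trivial⟩
  isOpen_inter := by
    classical
    intro U V hU hV σ hσ
    obtain ⟨S, hS⟩ := hU σ hσ.1
    obtain ⟨T, hT⟩ := hV σ hσ.2
    exact ⟨S ∪ T, fun τ h => ⟨hS τ fun x hx => h x (Finset.mem_union_left _ hx),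
      hT τ fun x hx => h x (Finset.mem_union_right _ hx)⟩⟩
  isOpen_sUnion := by
    intro 𝒰 h𝒰 σ hσ
    obtain ⟨U, hU, hσU⟩ := hσ
    obtain ⟨S, hS⟩ := h𝒰 U hU σ hσU
    exact ⟨S, fun τ h => ⟨U, hU, hS τ h⟩⟩

section Valuations

variable {F : Type*} [Field F]

/-- The valuation group `Γ = Fˣ / 𝒪ˣ` of a valuation ring `𝒪` of `F`, written additively. -/
def valuationGroup (O : ValuationSubring F) : Type _ :=
  Additive (Fˣ ⧸ O.unitGroup)

noncomputable instance valuationGroup.instAddCommGroup (O : ValuationSubring F) : AddCommGroup (valuationGroup O) :=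
  inferInstanceAs (AddCommGroup (Additive (Fˣ ⧸ O.unitGroup)))

/-- The natural projection `v : Fˣ → Γ`. -/
noncomputable def valuationClass (O : ValuationSubring F) (t : Fˣ) : valuationGroup O :=
  Additive.ofMul (QuotientGroup.mk t)

/-- If `k ⊆ 𝒪`, the residue field `κ(v)` is an extension of `k`. -/
@[reducible] noncomputable def residueFieldAlgebra (k : Type*) [Field k] [Algebra k F] (O : ValuationSubring F)
    (hk : ∀ c : k, algebraMap k F c ∈ O) : Algebra k (IsLocalRing.ResidueField O) :=
  ((IsLocalRing.residue O).comp ((algebraMap k F).codRestrict O.toSubring hk)).toAlgebra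

/-- A valuation ring `𝒪 ⊇ k` with valuation group of rational rank `r` is discrete if there are a
lift `X ⊆ 𝒪` of a transcendence basis of the residue field over `k` and a lift `t₁, …, t_r ∈ Fˣ` of a
`ℚ`-basis of the valuation group such that `F` is algebraic over `k(X, t₁, …, t_r)`. (In a group of
rational rank `r`, a `ℤ`-independent family of length `r` is the same as a `ℚ`-basis of `ℚ ⊗ Γ`.) -/
def IsDiscreteValuationSubring (k : Type*) [Field k] [Algebra k F] (r : ℕ)
    (O : ValuationSubring F) (hk : ∀ c : k, algebraMap k F c ∈ O) : Prop :=
  letI := residueFieldAlgebra k O hk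
  ∃ (X : Set O) (t : Fin r → Fˣ),
    IsTranscendenceBasis k (fun x : X => IsLocalRing.residue O (x : O)) ∧
    LinearIndependent ℤ (fun j => valuationClass O (t j)) ∧
    Algebra.IsAlgebraic
      (IntermediateField.adjoin k
        (Set.range (fun x : X => ((x : O) : F)) ∪ Set.range (fun j => (t j : F)))) F

/-- The set `𝒫ʳ_F` of discrete valuation rings of `F` of rank `r` containing `k`. The rank is the
dimension of the `ℚ`-vector space `ℚ ⊗ Γ`, which is the `ℤ`-rank of `Γ`; for algebraically closed `F`
of characteristic zero `Γ` itself is a `ℚ`-vector space. -/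
def discreteValuationRings (k F : Type*) [Field k] [Field F] [Algebra k F] (r : ℕ) :
    Set (ValuationSubring F) :=
  {O | Module.rank ℤ (valuationGroup O) = r ∧
    ∃ hk : ∀ c : k, algebraMap k F c ∈ O, IsDiscreteValuationSubring k r O hk}

end Valuations

/-! The valuation ring `O` of a valuation in `discreteValuationRings k F 1` has a coefficient field:
a subfield `E` of `O`, algebraically closed in `F`, with `F` of transcendence degree one over it
(`exists_isCoeffField_of_mem_discreteValuationRings`). Then `E` represents every residue class, `O`
is archimedean, and two distinct such rings satisfy weak approximation
(`IsCoeffField.exists_approx`). Everything is proved for rings with a coefficient field.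

Conjugacy is the main tool. Let `O₁`, `O₂` have coefficient fields containing `A` and let `h` have a
pole at both. Matching transcendence bases makes the coefficient fields equal. If the rings then
agree on a subfield over which `F` is algebraic, hence Galois, an automorphism over that subfield
carries one to the other. This gives `exists_algEquiv_smul_eq`, and from it
`IsCoeffField.exists_apply_eq_of_congr`: under the decomposition group, elements congruent modulo
the maximal ideal are conjugate over any `A = acl k S ⊆ O` containing neither, with `S` finite.

For density, let `σ` and a finite `S` be given. Write `S ⊆ acl(A, s)` with `A = acl k S₀` for a
finite `S₀` and `s ∉ A`. On a curve over `A` whose function field contains `S`, a Riemann–Roch style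
dimension count yields a function `h` with its only pole at one unramified point, so a valuation
ring with a pole at `h` is determined on `S` (`exists_determinesValuation`). Approximation and
congruence conjugacy give `g₁`, `g₂` in the group `H` generated by the two decomposition groups such
that `g₁⁻¹ O'` contains `A` and misses `h`, while `g₂⁻¹ O'` contains `σ A` and misses `σ h`.
Conjugacy supplies `g`, equal to `σ` on `S`, carrying the first ring to the second. Hence `g₂ g
g₁⁻¹` stabilizes `O'`, and `g ∈ H`. Transitivity on embeddings follows from density and the
homogeneity of `F`.

A decomposition group is not open, because large prime order roots of `1 + t` can be moved while a
given finite set is fixed. It is maximal among proper closed subgroups, because a strictly larger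
group contains a second, conjugate decomposition group and is therefore dense. -/

/-! ### Relative algebraic closure and exchange. -/

section RelativeAlgebraicClosure

variable {k F : Type*} [Field k] [Field F] [Algebra k F]

variable (k) in
/-- The relative algebraic closure in `F` of the field generated over `k` by `S`. -/
noncomputable def acl (S : Set F) : IntermediateField k F :=
  (algebraicClosure (IntermediateField.adjoin k S) F).restrictScalars k

theorem mem_acl {S : Set F} {x : F} :
    x ∈ acl k S ↔ IsAlgebraic (IntermediateField.adjoin k S) x :=
  mem_algebraicClosure_iff

theorem mem_acl_coe {A : IntermediateField k F} {x : F} :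
    x ∈ acl k (A : Set F) ↔ IsAlgebraic A x := by
  rw [mem_acl, IntermediateField.adjoin_self]

theorem adjoin_le_acl (S : Set F) : IntermediateField.adjoin k S ≤ acl k S := fun x hx =>
  mem_acl.2 (isAlgebraic_algebraMap (⟨x, hx⟩ : IntermediateField.adjoin k S))

theorem subset_acl (S : Set F) : S ⊆ acl k S := fun _ hx =>
  adjoin_le_acl S (IntermediateField.subset_adjoin k S hx)

theorem acl_le_of_adjoin_le {S : Set F} {A : IntermediateField k F}
    (h : IntermediateField.adjoin k S ≤ A) {x : F} (hx : x ∈ acl k S) : IsAlgebraic A x := by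
  let := (IntermediateField.inclusion h).toRingHom.toAlgebra
  have : IsScalarTower (IntermediateField.adjoin k S) A F :=
    IsScalarTower.of_algebraMap_eq fun _ => rfl
  exact (mem_acl.1 hx).tower_top A

theorem acl_mono {S T : Set F} (h : S ⊆ T) : acl k S ≤ acl k T := fun _ hx =>
  mem_acl.2 (acl_le_of_adjoin_le (IntermediateField.adjoin.mono k _ _ h) hx)

/-- An intermediate field which is algebraically closed in the big field. -/
def IsRelClosed (A : IntermediateField k F) : Prop := ∀ x, IsAlgebraic A x → x ∈ A

theorem acl_le {S : Set F} {A : IntermediateField k F} (hA : IsRelClosed A) (h : S ⊆ A) :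
    acl k S ≤ A := fun x hx =>
  hA x (acl_le_of_adjoin_le (IntermediateField.adjoin_le_iff.2 h) hx)

theorem isRelClosed_acl (S : Set F) : IsRelClosed (acl k S) := fun x hx => by
  have : IsAlgebraic (algebraicClosure (IntermediateField.adjoin k S) F) x := hx
  exact mem_acl.2 (this.restrictScalars (IntermediateField.adjoin k S))

theorem acl_le_acl {S T : Set F} (h : S ⊆ acl k T) : acl k S ≤ acl k T :=
  acl_le (isRelClosed_acl T) h

theorem IsRelClosed.acl_eq {A : IntermediateField k F} (hA : IsRelClosed A) :
    acl k (A : Set F) = A :=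
  le_antisymm (acl_le hA le_rfl) (subset_acl _)

theorem mem_acl_iff_mem_closure {S : Set F} {x : F} :
    x ∈ acl k S ↔ x ∈ (AlgebraicIndependent.matroid k F).closure S := by
  rw [AlgebraicIndependent.matroid_closure_eq, SetLike.mem_coe, mem_acl]
  exact (IntermediateField.isAlgebraic_adjoin_iff (F := k) (E := F) (s := S) (x := x)).trans Iff.rfl

theorem acl_exchange {S : Set F} {x y : F} (hx : x ∈ acl k (insert y S)) (hx' : x ∉ acl k S) :
    y ∈ acl k (insert x S) := by
  rw [mem_acl_iff_mem_closure] at *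
  exact ((AlgebraicIndependent.matroid k F).closure_exchange ⟨hx, hx'⟩).1

theorem acl_insert_acl (S : Set F) (x : F) :
    acl k (insert x (acl k S : Set F)) = acl k (insert x S) := by
  apply le_antisymm
  · refine acl_le_acl (Set.insert_subset (subset_acl _ (Set.mem_insert _ _)) ?_)
    exact acl_mono (Set.subset_insert _ _)
  · exact acl_mono (Set.insert_subset_insert (subset_acl _))

theorem map_mem_acl_image (σ : F ≃ₐ[k] F) {S : Set F} {x : F} (hx : x ∈ acl k S) :
    σ x ∈ acl k (σ '' S) := by
  have h : acl k S ≤ (acl k (σ '' S)).comap (σ : F →ₐ[k] F) := by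
    refine acl_le (fun y hy => ?_) fun y hy => subset_acl _ ⟨y, hy, rfl⟩
    refine isRelClosed_acl (σ '' S) (σ y) ?_
    obtain ⟨p, hp, hpy⟩ := hy
    let f : (acl k (σ '' S)).comap (σ : F →ₐ[k] F) →+* acl k (σ '' S) :=
      { toFun := fun z => ⟨σ z, z.2⟩
        map_one' := by ext; simp
        map_mul' := fun a b => by ext; simp
        map_zero' := by ext; simp
        map_add' := fun a b => by ext; simp }
    refine ⟨p.map f, (Polynomial.map_ne_zero_iff f.injective).2 hp, ?_⟩
    have := congrArg σ hpy
    rw [map_zero] at this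
    rw [← this, Polynomial.aeval_def, Polynomial.aeval_def, Polynomial.eval₂_map]
    exact (Polynomial.hom_eval₂ p (algebraMap _ F) (σ : F →+* F) y).symm
  exact h hx

theorem map_acl (σ : F ≃ₐ[k] F) (S : Set F) :
    (acl k S).map (σ : F →ₐ[k] F) = acl k (σ '' S) := by
  apply le_antisymm
  · rintro _ ⟨x, hx, rfl⟩
    exact map_mem_acl_image σ hx
  · intro x hx
    refine ⟨σ.symm x, ?_, by simp⟩
    have := map_mem_acl_image σ.symm hx
    rwa [← Set.image_comp, show (σ.symm ∘ σ : F → F) = id from funext fun z => by simp,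
      Set.image_id] at this

theorem image_acl (σ : F ≃ₐ[k] F) (S : Set F) :
    σ '' (acl k S : Set F) = acl k (σ '' S) := by
  rw [← map_acl]; rfl

theorem image_notMem (σ : F ≃ₐ[k] F) {S : Set F} {x : F} (h : x ∉ acl k S) :
    σ x ∉ acl k (σ '' S) := by
  rw [← SetLike.mem_coe, ← image_acl]
  rintro ⟨y, hy, hxy⟩
  exact h (σ.injective hxy ▸ hy)

theorem isAlgClosed_of_isRelClosed [IsAlgClosed F] {A : IntermediateField k F}
    (hA : IsRelClosed A) : IsAlgClosed A := by
  refine IsAlgClosed.of_exists_root A fun p _ hp => ?_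
  obtain ⟨x, hx⟩ := IsAlgClosed.exists_aeval_eq_zero F p hp.degree_pos.ne'
  have hxA : x ∈ A := hA x ⟨p, hp.ne_zero, hx⟩
  refine ⟨⟨x, hxA⟩, Subtype.val_injective ?_⟩
  refine Eq.trans ?_ hx
  exact (Polynomial.aeval_algebraMap_apply_eq_algebraMap_eval (A := F)
    (⟨x, hxA⟩ : A) p).symm

theorem IsRelClosed.notMem_iff_transcendental {A : IntermediateField k F} (hA : IsRelClosed A)
    {x : F} : x ∉ A ↔ Transcendental A x :=
  ⟨fun h h' => h (hA x h'), fun h hx => h (isAlgebraic_algebraMap (⟨x, hx⟩ : A))⟩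

theorem isAlgebraic_of_forall_mem_acl {M : IntermediateField k F}
    (h : ∀ x, x ∈ acl k (M : Set F)) : Algebra.IsAlgebraic M F :=
  ⟨fun x => mem_acl_coe.1 (h x)⟩

end RelativeAlgebraicClosure

/-! ### Automorphisms from transcendence bases. -/

section Homogeneity

variable {k F : Type*} [Field k] [Field F] [Algebra k F]

theorem IsAlgClosed.exists_ringEquiv_of_isTranscendenceBasis {R K L ι κ : Type*} [Field R]
    [Field K] [Field L] [Algebra R K] [Algebra R L] [IsAlgClosed K] [IsAlgClosed L]
    {v : ι → K} {w : κ → L} (e : ι ≃ κ) (hv : IsTranscendenceBasis R v)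
    (hw : IsTranscendenceBasis R w) : ∃ σ : K ≃ₐ[R] L, ∀ i, σ (v i) = w (e i) := by
  let := IsAlgClosed.isAlgClosure_of_transcendence_basis v hv
  let := IsAlgClosed.isAlgClosure_of_transcendence_basis w hw
  let f : Algebra.adjoin R (Set.range v) ≃ₐ[R] Algebra.adjoin R (Set.range w) :=
    hv.1.aevalEquiv.symm.trans ((MvPolynomial.renameEquiv R e).trans hw.1.aevalEquiv)
  let g : K ≃+* L := IsAlgClosure.equivOfEquiv K L f.toRingEquiv
  have hg : ∀ x, g (algebraMap _ K x) = algebraMap _ L (f x) := fun x =>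
    IsAlgClosure.equivOfEquiv_algebraMap K L f.toRingEquiv x
  refine ⟨AlgEquiv.ofRingEquiv (f := g) fun r => ?_, fun i => ?_⟩
  · rw [IsScalarTower.algebraMap_apply R (Algebra.adjoin R (Set.range v)) K, hg, f.commutes]
    rfl
  · have h1 := hg ⟨v i, Algebra.subset_adjoin ⟨i, rfl⟩⟩
    refine h1.trans ?_
    have h2 : hv.1.aevalEquiv.symm ⟨v i, Algebra.subset_adjoin ⟨i, rfl⟩⟩ = MvPolynomial.X i := by
      rw [AlgEquiv.symm_apply_eq]
      ext
      simp
    simp only [f, AlgEquiv.trans_apply, h2, MvPolynomial.renameEquiv_apply, MvPolynomial.rename_X]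
    simp

/-- Extend `b` and `z` to transcendence bases over `A`. These have equal cardinality, and a
transposition corrects the bijection so that `b` goes to `z`. -/
theorem exists_algEquiv_apply_eq [IsAlgClosed F] {A : IntermediateField k F} {b z : F}
    (hb : Transcendental A b) (hz : Transcendental A z) : ∃ σ : F ≃ₐ[A] F, σ b = z := by
  classical
  have key : ∀ x : F, Transcendental A x →
      ∃ u : Set F, x ∈ u ∧ IsTranscendenceBasis A ((↑) : u → F) := by
    intro x hx
    have : Algebra.IsAlgebraic (Algebra.adjoin A (Set.univ : Set F)) F :=
      ⟨fun y => isAlgebraic_algebraMap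
        (⟨y, Algebra.subset_adjoin trivial⟩ : Algebra.adjoin A (Set.univ : Set F))⟩
    obtain ⟨u, hu, -, h⟩ := exists_isTranscendenceBasis_between (R := A) {x} Set.univ
      (Set.subset_univ _) (algebraicIndependent_unique_type_iff.2 (by simpa using! hx))
    exact ⟨u, hu rfl, h⟩
  obtain ⟨u, hbu, hu⟩ := key b hb
  obtain ⟨w, hzw, hw⟩ := key z hz
  obtain ⟨e⟩ := Cardinal.eq.1 (hu.cardinalMk_eq hw)
  obtain ⟨σ, hσ⟩ := IsAlgClosed.exists_ringEquiv_of_isTranscendenceBasis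
    (e.trans (Equiv.swap (e ⟨b, hbu⟩) ⟨z, hzw⟩)) hu hw
  exact ⟨σ, by simpa using hσ ⟨b, hbu⟩⟩

end Homogeneity

/-! ### Conjugacy of valuation rings in algebraic extensions. -/

section ValuationSubrings

variable {F : Type*} [Field F]

namespace ValuationSubring

theorem valuation_lt_one_of_inv_notMem {O : ValuationSubring F} {x : F} (h : x⁻¹ ∉ O) :
    O.valuation x < 1 :=
  O.mem_nonunits_iff.1 (O.mem_nonunits_iff_or.2 (Or.inr h))

theorem valuation_inv_lt_one {O : ValuationSubring F} {x : F} (h : x ∉ O) :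
    O.valuation x⁻¹ < 1 :=
  valuation_lt_one_of_inv_notMem (by rwa [inv_inv])

theorem mem_of_valuation_lt_one {O : ValuationSubring F} {x : F} (h : O.valuation x < 1) :
    x ∈ O :=
  O.mem_of_valuation_le_one x h.le

theorem inv_notMem_of_valuation_lt_one {O : ValuationSubring F} {x : F} (h0 : x ≠ 0)
    (h : O.valuation x < 1) : x⁻¹ ∉ O :=
  ((O.mem_nonunits_iff_or.1 (O.mem_nonunits_iff.2 h)).resolve_left h0)

theorem valuation_eq_one_of_mem {O : ValuationSubring F} {x : F} (h0 : x ≠ 0) (hx : x ∈ O)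
    (hx' : x⁻¹ ∈ O) : O.valuation x = 1 := by
  refine le_antisymm ((O.valuation_le_one_iff x).2 hx) (not_lt.1 fun h => ?_)
  exact inv_notMem_of_valuation_lt_one h0 h hx'

theorem mem_of_isIntegral {O : ValuationSubring F} {R : Type*} [CommRing R] [Algebra R F]
    (hR : ∀ r : R, algebraMap R F r ∈ O) {x : F} (hx : IsIntegral R x) : x ∈ O := by
  let f : R →+* O := (algebraMap R F).codRestrict O.toSubring hR
  obtain ⟨p, hp, hpx⟩ := hx
  have : IsIntegral O x := ⟨p.map f, hp.map f, by rw [Polynomial.eval₂_map]; exact hpx⟩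
  obtain ⟨y, rfl⟩ := IsIntegrallyClosed.isIntegral_iff.1 this
  exact y.2

end ValuationSubring

open ValuationSubring

variable {K : Type*} [Field K] [Algebra K F]

/-- Two valuation rings of an algebraic extension `F` of `K` with the same restriction to `K` and
whose maximal ideals have the same integral elements are equal. -/
theorem ValuationSubring.le_of_integral [Algebra.IsAlgebraic K F] {O O' : ValuationSubring F}
    (R : Subring F) (hR : ∀ x : K, algebraMap K F x ∈ O → algebraMap K F x ∈ R)
    (h : ∀ x : K, algebraMap K F x ∈ O → algebraMap K F x ∈ O')
    (hm : ∀ b : F, IsIntegral R b → O'.valuation b < 1 → O.valuation b < 1) : O ≤ O' := by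
  classical
  intro x hx
  by_contra hx'
  have hx0 : x ≠ 0 := by rintro rfl; exact hx' O'.zero_mem
  -- an algebraic equation with integral coefficients, one of them a unit
  obtain ⟨p, hp0, hpx⟩ := Algebra.IsAlgebraic.isAlgebraic (R := K) x
  have hne : p.support.Nonempty := Polynomial.support_nonempty.2 hp0
  obtain ⟨i₀, hi₀, hmax⟩ := p.support.exists_max_image
    (fun i => O.valuation (algebraMap K F (p.coeff i))) hne
  have hc0 : p.coeff i₀ ≠ 0 := Polynomial.mem_support_iff.1 hi₀
  set q := Polynomial.C (p.coeff i₀)⁻¹ * p with hq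
  have hqx : Polynomial.aeval x q = 0 := by rw [hq, map_mul, hpx, mul_zero]
  have hqO : ∀ i, algebraMap K F (q.coeff i) ∈ O := fun i => by
    rw [← O.valuation_le_one_iff, hq, Polynomial.coeff_C_mul, map_mul, map_mul, map_inv₀, map_inv₀]
    by_cases hi : i ∈ p.support
    · have hpos : 0 < O.valuation (algebraMap K F (p.coeff i₀)) := by
        rw [zero_lt_iff]; simpa using hc0
      calc _ ≤ (O.valuation (algebraMap K F (p.coeff i₀)))⁻¹ *
            O.valuation (algebraMap K F (p.coeff i₀)) := mul_le_mul_right (hmax i hi) _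
        _ ≤ 1 := by rw [inv_mul_cancel₀ hpos.ne']
    · rw [Polynomial.notMem_support_iff.1 hi]; simp
  have hq1 : q.coeff i₀ = 1 := by rw [hq, Polynomial.coeff_C_mul, inv_mul_cancel₀ hc0]
  -- the largest index of a unit coefficient
  have hex : ∃ j, O.valuation (algebraMap K F (q.coeff j)) = 1 := ⟨i₀, by rw [hq1]; simp⟩
  have hbd : ∀ j, O.valuation (algebraMap K F (q.coeff j)) = 1 → j ≤ q.natDegree := fun j hj => by
    refine Polynomial.le_natDegree_of_ne_zero fun h0 => ?_
    rw [h0] at hj; simp at hj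
  set j := Nat.findGreatest (fun j => O.valuation (algebraMap K F (q.coeff j)) = 1) q.natDegree
  have hj : O.valuation (algebraMap K F (q.coeff j)) = 1 :=
    Nat.findGreatest_spec (P := fun j => O.valuation (algebraMap K F (q.coeff j)) = 1)
      (hbd _ hex.choose_spec) hex.choose_spec
  have hj' : ∀ i, j < i → O.valuation (algebraMap K F (q.coeff i)) < 1 := fun i hi => by
    refine lt_of_le_of_ne ((O.valuation_le_one_iff _).2 (hqO i)) fun h1 => ?_
    exact Nat.findGreatest_is_greatest hi (hbd i h1) h1
  -- split the equation at that index
  let b : F := ∑ i ∈ (Finset.range (q.natDegree + 1)).filter (j ≤ ·),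
    algebraMap K F (q.coeff i) * x ^ (i - j)
  let c : F := ∑ i ∈ (Finset.range (q.natDegree + 1)).filter (fun i => ¬ j ≤ i),
    algebraMap K F (q.coeff i) * (x⁻¹) ^ (j - 1 - i)
  have hbc : x * b = - c := by
    have h1 : x ^ j * b = - ∑ i ∈ (Finset.range (q.natDegree + 1)).filter (fun i => ¬ j ≤ i),
        algebraMap K F (q.coeff i) * x ^ i := by
      rw [eq_neg_iff_add_eq_zero, ← hqx, Polynomial.aeval_eq_sum_range,
        ← Finset.sum_filter_add_sum_filter_not (Finset.range (q.natDegree + 1)) (j ≤ ·),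
        Finset.mul_sum]
      congr 1
      · refine Finset.sum_congr rfl fun i hi => ?_
        rw [Algebra.smul_def, mul_left_comm, ← pow_add,
          Nat.add_sub_cancel' (Finset.mem_filter.1 hi).2]
      · exact Finset.sum_congr rfl fun i _ => (Algebra.smul_def _ _).symm
    rcases Nat.eq_zero_or_pos j with hj0 | hj0
    · have hb0 : b = 0 := by simpa [hj0] using h1
      have : c = 0 := by simp [c, hj0]
      rw [hb0, this]; simp
    · have hxj : x ^ (j - 1) ≠ 0 := pow_ne_zero _ hx0
      apply mul_left_cancel₀ hxj
      rw [← mul_assoc, ← pow_succ, Nat.sub_add_cancel hj0, h1, mul_neg, Finset.mul_sum]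
      congr 1
      refine Finset.sum_congr rfl fun i hi => ?_
      have hij : i ≤ j - 1 := Nat.le_sub_one_of_lt (not_le.1 (Finset.mem_filter.1 hi).2)
      rw [mul_left_comm]
      congr 1
      rw [inv_pow, ← div_eq_mul_inv, eq_div_iff (pow_ne_zero _ hx0), ← pow_add,
        Nat.add_sub_cancel' hij]
  have hb_mem : ∀ V : ValuationSubring F, (∀ i, algebraMap K F (q.coeff i) ∈ V) → x ∈ V →
      b ∈ V := fun V hV hxV =>
    V.toSubring.sum_mem fun i _ => V.mul_mem _ _ (hV i) (V.toSubring.pow_mem hxV _)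
  have hc_mem : ∀ V : ValuationSubring F, (∀ i, algebraMap K F (q.coeff i) ∈ V) → x⁻¹ ∈ V →
      x * b ∈ V := fun V hV hxV => by
    rw [hbc]
    exact V.neg_mem _ (V.toSubring.sum_mem fun i _ =>
      V.mul_mem _ _ (hV i) (V.toSubring.pow_mem hxV _))
  -- The integral closure of `R` is the intersection of the valuation rings containing it. In each
  -- of these, use the formula for `b` if `x` is integral, and `b = x⁻¹ (x b)` otherwise.
  have hbint : IsIntegral R b := by
    have h1 : b ∈ ⨅ V : {V : ValuationSubring F // (R : Set F) ⊆ V.toSubring}, V.1.toSubring := by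
      rw [Subring.mem_iInf]
      rintro ⟨V, hV⟩
      have hV' : ∀ i, algebraMap K F (q.coeff i) ∈ V := fun i => hV (hR _ (hqO i))
      rcases V.mem_or_inv_mem x with h | h
      · exact hb_mem V hV' h
      · have := V.mul_mem _ _ h (hc_mem V hV' h)
        rwa [inv_mul_cancel_left₀ hx0] at this
    rw [iInf_valuationSubring_superset, Subring.closure_eq] at h1
    exact h1
  have hxO' := hc_mem O' (fun i => h _ (hqO i)) ((O'.mem_or_inv_mem x).resolve_left hx')
  have hb1 : O'.valuation b < 1 := by
    have : b = x⁻¹ * (x * b) := by rw [inv_mul_cancel_left₀ hx0]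
    rw [this, map_mul]
    exact mul_lt_one_of_lt_of_le (valuation_inv_lt_one hx') ((O'.valuation_le_one_iff _).2 hxO')
  -- At `O` the element `b` is a unit: its `i = j` term is the unit coefficient, and all later
  -- coefficients lie in the maximal ideal.
  refine (hm b hbint hb1).ne ?_
  have hjmem : j ∈ (Finset.range (q.natDegree + 1)).filter (j ≤ ·) := by
    simp [hbd j hj]
  rw [show b = _ from (Finset.add_sum_erase _ _ hjmem).symm, Nat.sub_self, pow_zero, mul_one,
    Valuation.map_add_eq_of_lt_left _ ?_, hj]
  rw [hj]
  refine Valuation.map_sum_lt _ one_ne_zero fun i hi => ?_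
  rw [Finset.mem_erase, Finset.mem_filter] at hi
  rw [map_mul]
  exact mul_lt_one_of_lt_of_le (hj' i (lt_of_le_of_ne hi.2.2 (Ne.symm hi.1)))
    ((O.valuation_le_one_iff _).2 (O.toSubring.pow_mem hx _))

-- Let `B` be the integral closure in `F` of the common restriction `R`. The profinite Galois group
-- is transitive on the primes of `B` over a given prime of `R`, and `le_of_integral` recovers a
-- valuation ring from its centre on `B`.
open Pointwise in
theorem ValuationSubring.exists_smul_eq_of_agree [IsGalois K F] {O O' : ValuationSubring F}
    (h : ∀ x : K, algebraMap K F x ∈ O ↔ algebraMap K F x ∈ O') :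
    ∃ τ : F ≃ₐ[K] F, τ • O = O' := by
  let R : Subring F := (O.comap (algebraMap K F)).toSubring.map (algebraMap K F)
  have hRO : ∀ r ∈ R, r ∈ O := by rintro _ ⟨x, hx, rfl⟩; exact hx
  have hRO' : ∀ r ∈ R, r ∈ O' := by rintro _ ⟨x, hx, rfl⟩; exact (h x).1 hx
  have hR : ∀ x : K, algebraMap K F x ∈ O → algebraMap K F x ∈ R := fun x hx => ⟨x, hx, rfl⟩
  let B := integralClosure R F
  let G := F ≃ₐ[K] F
  have : SMulCommClass G R F := ⟨fun g a x => by
    obtain ⟨_, y, hy, rfl⟩ := a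
    change g (algebraMap K F y * x) = algebraMap K F y * g x
    rw [map_mul, g.commutes]⟩
  let _ : TopologicalSpace B := ⊥
  have : DiscreteTopology B := ⟨rfl⟩
  have : ContinuousSMul G B := by
    rw [continuousSMul_iff_stabilizer_isOpen]
    intro x
    convert stabilizer_isOpen_of_isIntegral (K := K) (x : F) using 1
    ext g
    exact Subtype.ext_iff
  have : Algebra.IsInvariant R B G := ⟨fun b hb => by
    have hb' : (b : F) ∈ IntermediateField.fixedField (⊤ : Subgroup (F ≃ₐ[K] F)) := by
      rintro ⟨g, -⟩
      exact congrArg Subtype.val (hb g)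
    rw [InfiniteGalois.fixedField_bot, IntermediateField.mem_bot] at hb'
    obtain ⟨y, hy⟩ := hb'
    have hyO : algebraMap K F y ∈ O := by
      rw [hy]; exact mem_of_isIntegral (R := R) (fun r => hRO r r.2) b.2
    exact ⟨⟨_, hR y hyO⟩, Subtype.ext hy⟩⟩
  have hBO : ∀ (V : ValuationSubring F), (∀ r ∈ R, r ∈ V) → ∀ b : B, (b : F) ∈ V :=
    fun V hV b => mem_of_isIntegral (R := R) (fun r => hV r r.2) b.2
  let f (V : ValuationSubring F) (hV : ∀ r ∈ R, r ∈ V) : B →+* V :=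
    (algebraMap B F).codRestrict V.toSubring (hBO V hV)
  let P (V : ValuationSubring F) (hV : ∀ r ∈ R, r ∈ V) : Ideal B :=
    (IsLocalRing.maximalIdeal V).comap (f V hV)
  have hP : ∀ V hV b, b ∈ P V hV ↔ V.valuation (b : F) < 1 := fun V hV b =>
    (V.valuation_lt_one_iff _)
  have (V : ValuationSubring F) (hV : ∀ r ∈ R, r ∈ V) : (P V hV).IsPrime := Ideal.comap_isPrime _ _
  have hlt : ∀ x ∈ R, (O.valuation x < 1 ↔ O'.valuation x < 1) := by
    rintro _ ⟨x, hx, rfl⟩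
    rw [← O.mem_nonunits_iff, ← O'.mem_nonunits_iff, O.mem_nonunits_iff_or, O'.mem_nonunits_iff_or,
      ← map_inv₀, h]
  obtain ⟨g, hg⟩ := Algebra.IsInvariant.exists_smul_of_under_eq_of_profinite (A := R) (B := B)
    (G := G) (P O hRO) (P O' hRO') (by
      ext r
      exact (hP O hRO (algebraMap R B r)).trans
        ((hlt r r.2).trans (hP O' hRO' (algebraMap R B r)).symm))
  have hgR : ∀ V : ValuationSubring F, ∀ x : K, algebraMap K F x ∈ g • V ↔ algebraMap K F x ∈ V := by
    intro V x
    rw [ValuationSubring.mem_pointwise_smul_iff_inv_smul_mem]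
    change g⁻¹ (algebraMap K F x) ∈ V ↔ _
    rw [AlgEquiv.commutes]
  have hval : ∀ b : F, IsIntegral R b → ((g • O).valuation b < 1 ↔ O'.valuation b < 1) := by
    intro b hb
    have h1 : (⟨b, hb⟩ : B) ∈ g • P O hRO ↔ O'.valuation b < 1 := by rw [← hg]; exact hP O' hRO' _
    rw [← h1, Ideal.mem_pointwise_smul_iff_inv_smul_mem, hP O hRO, ← mem_nonunits_iff, ← mem_nonunits_iff,
      mem_nonunits_iff_or, mem_nonunits_iff_or, mem_pointwise_smul_iff_inv_smul_mem]
    change (b = 0 ∨ g⁻¹ b⁻¹ ∉ O) ↔ (g⁻¹ b = 0 ∨ (g⁻¹ b)⁻¹ ∉ O)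
    rw [map_inv₀, map_eq_zero_iff _ (AlgEquiv.injective _)]
  refine ⟨g, le_antisymm ?_ ?_⟩
  · exact le_of_integral R (fun x hx => hR x ((hgR O x).1 hx)) (fun x hx => (h x).1 ((hgR O x).1 hx))
      fun b hb => (hval b hb).2
  · exact le_of_integral R (fun x hx => hR x ((h x).2 hx)) (fun x hx => (hgR O x).2 ((h x).2 hx))
      fun b hb => (hval b hb).1

end ValuationSubrings

/-! ### Coefficient fields: residues, approximation, enlargement. -/

section CoefficientFields

open ValuationSubring

variable {k F : Type*} [Field k] [Field F] [Algebra k F]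

theorem mem_acl_union_iff {A : IntermediateField k F} {Y : Set F} {x : F} :
    x ∈ acl k ((A : Set F) ∪ Y) ↔ x ∈ acl A Y := by
  rw [mem_acl, mem_acl, ← IntermediateField.restrictScalars_adjoin]
  rfl

theorem mem_acl_insert_iff {A : IntermediateField k F} {b x : F} :
    x ∈ acl k (insert b (A : Set F)) ↔ x ∈ acl A {b} := by
  rw [← mem_acl_union_iff, Set.union_singleton]

theorem ValuationSubring.mem_of_mem_acl {O : ValuationSubring F} {S : Set F}
    (h : ∀ x ∈ IntermediateField.adjoin k S, x ∈ O) {x : F} (hx : x ∈ acl k S) : x ∈ O :=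
  mem_of_isIntegral (R := IntermediateField.adjoin k S) (fun r => h r r.2) (mem_acl.1 hx).isIntegral

theorem ValuationSubring.valuation_eq_one_of_mem_field {O : ValuationSubring F}
    {A : IntermediateField k F} (hA : ∀ x ∈ A, x ∈ O) {a : F} (ha : a ∈ A) (h0 : a ≠ 0) :
    O.valuation a = 1 :=
  valuation_eq_one_of_mem h0 (hA a ha) (hA _ (A.inv_mem ha))

/-- As `A` is algebraically closed, a nonzero polynomial in `b` is a constant times factors `b - a`,
hence a unit. So `A(b) ⊆ O`, and `O` is integrally closed. -/
theorem ValuationSubring.acl_insert_subset [IsAlgClosed F] {O : ValuationSubring F}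
    {A : IntermediateField k F} (hAc : IsRelClosed A) (hA : ∀ x ∈ A, x ∈ O) {b : F}
    (hb : ∀ a ∈ A, O.valuation (b - a) = 1) {x : F} (hx : x ∈ acl k (insert b (A : Set F))) :
    x ∈ O := by
  have := isAlgClosed_of_isRelClosed hAc
  rw [mem_acl_insert_iff] at hx
  refine mem_of_mem_acl (k := A) (fun y hy => ?_) hx
  have hp : ∀ p : Polynomial A, p ≠ 0 → O.valuation (Polynomial.aeval b p) = 1 := fun p hp => by
    have hprod := congrArg (Polynomial.aeval b) (IsAlgClosed.splits p).eq_prod_roots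
    rw [map_mul, Polynomial.aeval_C, map_multiset_prod, Multiset.map_map] at hprod
    rw [hprod, map_mul, map_multiset_prod, Multiset.map_map, valuation_eq_one_of_mem_field hA
      (a := algebraMap A F p.leadingCoeff) (Subtype.coe_prop p.leadingCoeff) (by simpa using hp),
      one_mul]
    refine Multiset.prod_eq_one fun y hy => ?_
    obtain ⟨a, -, rfl⟩ := Multiset.mem_map.1 hy
    simpa using hb a a.2
  obtain ⟨r, s, rfl⟩ := IntermediateField.mem_adjoin_simple_iff A y |>.1 hy
  rw [← O.valuation_le_one_iff, map_div₀]
  by_cases hr : r = 0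
  · simp [hr]
  by_cases hs : s = 0
  · simp [hs]
  rw [hp r hr, hp s hs]
  simp

/-- A coefficient field of a valuation ring `O`: a subfield of `O`, algebraically closed in the
fraction field `F` of `O`, over which `F` has transcendence degree one. -/
structure IsCoeffField (O : ValuationSubring F) (E : IntermediateField k F) : Prop where
  isRelClosed : IsRelClosed E
  mem_of_mem : ∀ x ∈ E, x ∈ O
  exists_spanning : ∃ h ∉ O, ∀ x, x ∈ acl k (insert h (E : Set F))

namespace IsCoeffField

variable {O O' : ValuationSubring F} {E E' : IntermediateField k F}

theorem mem_acl_insert (hE : IsCoeffField O E) {h : F} (hh : h ∉ E) (x : F) :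
    x ∈ acl k (insert h (E : Set F)) := by
  obtain ⟨h', -, hs⟩ := hE.exists_spanning
  have h1 : h' ∈ acl k (insert h (E : Set F)) :=
    acl_exchange (hs h) (by rwa [hE.isRelClosed.acl_eq])
  exact acl_le_acl (Set.insert_subset h1
    ((Set.subset_insert _ _).trans (subset_acl _))) (hs x)

/-- Surjectivity of `E` onto the residue field. If `b` had no representative in `E`, then
`acl_insert_subset` would put all of `F = acl(E, b)` inside `O`. -/
theorem exists_valuation_sub_lt_one [IsAlgClosed F] (hE : IsCoeffField O E) {b : F} (hb : b ∈ O) :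
    ∃ e ∈ E, O.valuation (b - e) < 1 := by
  by_contra! hcon
  have h1 : ∀ a ∈ E, O.valuation (b - a) = 1 := fun a ha => le_antisymm
    ((O.valuation_le_one_iff _).2 (O.toSubring.sub_mem hb (hE.mem_of_mem a ha))) (hcon a ha)
  obtain ⟨h, hh, -⟩ := hE.exists_spanning
  have hbE : b ∉ E := fun hbE => by simpa using h1 b hbE
  exact hh (acl_insert_subset hE.isRelClosed hE.mem_of_mem h1 (hE.mem_acl_insert hbE h))

/-- The archimedean property. The localization `V = O[r⁻¹]` is a valuation ring in which every `r -
e` with `e ∈ E` is a unit, so `V = F` by `acl_insert_subset`. -/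
theorem exists_pow_mul_mem [IsAlgClosed F] (hE : IsCoeffField O E) {r : F} (h0 : r ≠ 0)
    (hr : O.valuation r < 1) (a : F) : ∃ N : ℕ, r ^ N * a ∈ O := by
  have hrO := mem_of_valuation_lt_one hr
  have hmono : ∀ {x : F} {m n : ℕ}, m ≤ n → r ^ m * x ∈ O → r ^ n * x ∈ O := fun {x m n} hmn h => by
    rw [← Nat.sub_add_cancel hmn, pow_add, mul_assoc]
    exact O.mul_mem _ _ (O.toSubring.pow_mem hrO _) h
  let V : ValuationSubring F :=
    { carrier := {x | ∃ N : ℕ, r ^ N * x ∈ O}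
      mul_mem' := by
        rintro x y ⟨m, hm⟩ ⟨n, hn⟩
        refine ⟨m + n, ?_⟩
        rw [pow_add, mul_mul_mul_comm]
        exact O.mul_mem _ _ hm hn
      one_mem' := ⟨0, by simp⟩
      add_mem' := by
        rintro x y ⟨m, hm⟩ ⟨n, hn⟩
        refine ⟨max m n, ?_⟩
        rw [mul_add]
        exact O.add_mem _ _ (hmono (le_max_left _ _) hm) (hmono (le_max_right _ _) hn)
      zero_mem' := ⟨0, by simp⟩
      neg_mem' := by
        rintro x ⟨m, hm⟩
        exact ⟨m, by rw [mul_neg]; exact O.neg_mem _ hm⟩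
      mem_or_inv_mem' := fun x => (O.mem_or_inv_mem x).imp
        (fun h => ⟨0, by simpa using h⟩) fun h => ⟨0, by simpa using h⟩ }
  have hOV : ∀ x ∈ O, x ∈ V := fun x hx => ⟨0, by simpa using hx⟩
  have hrV : r⁻¹ ∈ V := ⟨1, by simp [h0]⟩
  have hrE : r ∉ E := fun h => hr.ne (valuation_eq_one_of_mem_field hE.mem_of_mem h h0)
  refine acl_insert_subset (O := V) hE.isRelClosed (fun x hx => hOV x (hE.mem_of_mem x hx))
    (fun e he => ?_) (hE.mem_acl_insert hrE a)
  by_cases he0 : e = 0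
  · rw [he0, sub_zero]
    exact valuation_eq_one_of_mem h0 (hOV r hrO) hrV
  · have h1 : O.valuation (r - e) = 1 := by
      have h2 := valuation_eq_one_of_mem_field hE.mem_of_mem he he0
      rw [Valuation.map_sub_eq_of_lt_right _ (by rwa [h2]), h2]
    refine valuation_eq_one_of_mem (fun h => by rw [h, map_zero] at h1; exact zero_ne_one h1)
      (hOV _ ((O.valuation_le_one_iff _).1 h1.le)) (hOV _ ?_)
    rw [← O.valuation_le_one_iff, map_inv₀, h1, inv_one]

theorem eq_of_le [IsAlgClosed F] (hE : IsCoeffField O E) (hE' : IsCoeffField O' E') (h : O ≤ O') :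
    O = O' := by
  refine le_antisymm h fun x hx' => ?_
  by_contra hx
  have hx0 : x ≠ 0 := by rintro rfl; exact hx O.zero_mem
  obtain ⟨a, ha, -⟩ := hE'.exists_spanning
  obtain ⟨N, hN⟩ := hE.exists_pow_mul_mem (inv_ne_zero hx0) (valuation_inv_lt_one hx) a
  apply ha
  have := O'.mul_mem _ _ (O'.toSubring.pow_mem hx' N) (h hN)
  rwa [← mul_assoc, ← mul_pow, mul_inv_cancel₀ hx0, one_pow, one_mul] at this

/-- Neither ring contains the other, so some `r` has positive value at `O` and negative value at
`O'`. By the archimedean property `r ^ M / (1 + r ^ M)` is as close as needed to `0` at `O` and to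
`1` at `O'` for large `M`. -/
theorem exists_approx [IsAlgClosed F] (hE : IsCoeffField O E) (hE' : IsCoeffField O' E')
    (hne : O ≠ O') (e e' : F) :
    ∃ z, O.valuation (z - e) < 1 ∧ O'.valuation (z - e') < 1 := by
  obtain ⟨p, hp, hp'⟩ := SetLike.not_le_iff_exists.1 fun h => hne (hE.eq_of_le hE' h)
  obtain ⟨q, hq', hq⟩ := SetLike.not_le_iff_exists.1 fun h => hne (hE'.eq_of_le hE h).symm
  have hp0 : p ≠ 0 := by rintro rfl; exact hp' O'.zero_mem
  have hq0 : q ≠ 0 := by rintro rfl; exact hq O.zero_mem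
  set r := p * q⁻¹ with hr
  have hr0 : r ≠ 0 := mul_ne_zero hp0 (inv_ne_zero hq0)
  have hrv : O.valuation r < 1 := by
    rw [hr, mul_comm, map_mul]
    exact mul_lt_one_of_lt_of_le (valuation_inv_lt_one hq) ((O.valuation_le_one_iff p).2 hp)
  have hrv' : O'.valuation r⁻¹ < 1 := by
    rw [hr, mul_inv, inv_inv, map_mul]
    exact mul_lt_one_of_lt_of_le (valuation_inv_lt_one hp') ((O'.valuation_le_one_iff q).2 hq')
  have key : ∀ {V : ValuationSubring F} {D : IntermediateField k F}, IsCoeffField V D →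
      ∀ {s : F}, s ≠ 0 → V.valuation s < 1 → ∀ a : F, ∃ N, ∀ M, N < M →
        V.valuation (a * s ^ M / (1 + s ^ M)) < 1 := by
    intro V D hD s hs0 hs a
    obtain ⟨N, hN⟩ := hD.exists_pow_mul_mem hs0 hs a
    refine ⟨N, fun M hM => ?_⟩
    have h1 : V.valuation (s ^ M) < 1 := by
      rw [map_pow]; exact pow_lt_one₀ zero_le hs (by omega)
    have h2 : V.valuation (1 + s ^ M) = 1 := by
      rw [Valuation.map_add_eq_of_lt_left _ (by simpa using h1), map_one]
    rw [map_div₀, h2, div_one, ← Nat.sub_add_cancel hM.le, pow_add, mul_left_comm, mul_comm a,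
      map_mul]
    refine mul_lt_one_of_lt_of_le ?_ ((V.valuation_le_one_iff _).2 hN)
    rw [map_pow]; exact pow_lt_one₀ zero_le hs (by omega)
  obtain ⟨N, hN⟩ := key hE hr0 hrv (e' - e)
  obtain ⟨N', hN'⟩ := key hE' (inv_ne_zero hr0) hrv' (e - e')
  set M := max N N' + 1
  have hM := hN M (Nat.lt_succ_of_le (le_max_left _ _))
  have hM' := hN' M (Nat.lt_succ_of_le (le_max_right _ _))
  have h1 : (1 + r ^ M) ≠ 0 := fun h => by
    have h2 : r ^ M = -1 := by linear_combination h
    have h3 : O.valuation (r ^ M) < 1 := by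
      rw [map_pow]; exact pow_lt_one₀ zero_le hrv (by omega)
    rw [h2, Valuation.map_neg, map_one] at h3
    exact lt_irrefl _ h3
  have h2 : (1 + r⁻¹ ^ M) = (1 + r ^ M) * (r ^ M)⁻¹ := by
    rw [inv_pow, add_mul, mul_inv_cancel₀ (pow_ne_zero _ hr0)]; ring
  refine ⟨e + (e' - e) * r ^ M / (1 + r ^ M), by rwa [add_sub_cancel_left], ?_⟩
  convert hM' using 2
  rw [h2, inv_pow]
  have := pow_ne_zero M hr0
  field_simp
  ring

/-- Exchange: if `b ∉ E` is congruent to `e ∈ E`, then `e` is transcendental over `A`, and replacing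
it by `b` in a transcendence basis of `E` over `A` gives the new coefficient field. -/
theorem exists_insert [IsAlgClosed F] (hE : IsCoeffField O E) {A : IntermediateField k F}
    (hAE : A ≤ E) {b : F} (hb : ∀ x ∈ acl k (insert b (A : Set F)), x ∈ O) :
    ∃ E' : IntermediateField k F, IsCoeffField O E' ∧ acl k (insert b (A : Set F)) ≤ E' := by
  by_cases hbE : b ∈ E
  · exact ⟨E, hE, acl_le hE.isRelClosed (Set.insert_subset hbE hAE)⟩
  obtain ⟨e, heE, hbe⟩ := hE.exists_valuation_sub_lt_one
    (hb b (subset_acl _ (Set.mem_insert _ _)))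
  have hbe0 : b - e ≠ 0 := fun h => hbE (by rwa [sub_eq_zero.1 h])
  have hbeO : (b - e)⁻¹ ∉ O := inv_notMem_of_valuation_lt_one hbe0 hbe
  have hbeE : b - e ∉ E := fun h => hbE (by simpa using E.add_mem h heE)
  -- Otherwise `(b - e)⁻¹` lies in `acl(A, b) ⊆ O`, although `b - e` is in the maximal ideal.
  have heA : Transcendental A e := fun hcon => by
    replace hcon := mem_acl_coe.2 hcon
    refine hbeO (hb _ (inv_mem (sub_mem (subset_acl _ (Set.mem_insert _ _)) ?_)))
    exact acl_mono (Set.subset_insert _ _) hcon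
  have hspan : ∀ x, x ∈ acl A (insert (b - e) (E : Set F)) := fun x => by
    rw [← mem_acl_union_iff]
    exact acl_mono Set.subset_union_right (hE.mem_acl_insert hbeE x)
  have : Algebra.IsAlgebraic (Algebra.adjoin A (insert (b - e) (E : Set F))) F :=
    ⟨fun x => IntermediateField.isAlgebraic_adjoin_iff.1 (mem_acl.1 (hspan x))⟩
  obtain ⟨u, heu, hu, hbase⟩ := exists_isTranscendenceBasis_between (R := A) {e}
    (insert (b - e) (E : Set F)) (Set.singleton_subset_iff.2 (Set.mem_insert_of_mem _ heE))
    (algebraicIndependent_unique_type_iff.2 (by simpa using! heA))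
  rw [← AlgebraicIndependent.matroid_isBase_iff] at hbase
  set Y := u \ {e, b - e}
  set D := acl k ((A : Set F) ∪ Y) with hD
  have hYE : Y ⊆ E := fun y hy =>
    (hu hy.1).resolve_left fun h => hy.2 (Set.mem_insert_of_mem _ h)
  have hDE : D ≤ E := acl_le hE.isRelClosed (Set.union_subset hAE hYE)
  have heD : e ∉ D := fun h => by
    rw [hD, mem_acl_union_iff, mem_acl_iff_mem_closure] at h
    refine hbase.indep.notMem_closure_sdiff_of_mem (heu rfl) ?_
    refine (AlgebraicIndependent.matroid A F).closure_subset_closure ?_ h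
    exact Set.sdiff_subset_sdiff_right (by simp)
  have hDO : ∀ x ∈ D, x ∈ O := fun x hx => hE.mem_of_mem x (hDE hx)
  set E₁ := acl k (insert b (D : Set F))
  refine ⟨E₁, ⟨isRelClosed_acl _, fun x hx => ?_, (b - e)⁻¹, hbeO, fun x => ?_⟩, ?_⟩
  · refine acl_insert_subset (isRelClosed_acl _) hDO (fun d hd => ?_) hx
    have h1 : O.valuation (e - d) = 1 := valuation_eq_one_of_mem_field hE.mem_of_mem
      (sub_mem heE (hDE hd)) (sub_ne_zero.2 fun h => heD (h ▸ hd))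
    rw [← sub_add_sub_cancel b e d, Valuation.map_add_eq_of_lt_right _ (by rwa [h1]), h1]
  · have hx : x ∈ acl A u := by
      rw [mem_acl_iff_mem_closure, hbase.closure_eq]; trivial
    rw [← mem_acl_union_iff] at hx
    have hbe' : b - e ∈ acl k (insert (b - e)⁻¹ (E₁ : Set F)) := by
      rw [← inv_mem_iff]; exact subset_acl _ (Set.mem_insert _ _)
    have hE₁ : (E₁ : Set F) ⊆ acl k (insert (b - e)⁻¹ (E₁ : Set F)) :=
      (Set.subset_insert _ _).trans (subset_acl _)
    have hD₁ : (D : Set F) ⊆ E₁ := (Set.subset_insert _ _).trans (subset_acl _)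
    refine acl_le_acl (Set.union_subset ?_ fun y hy => ?_) hx
    · exact (Set.subset_union_left.trans (subset_acl _)).trans (hD₁.trans hE₁)
    · by_cases hye : y = e
      · rw [hye]
        have := sub_mem (hE₁ (subset_acl _ (Set.mem_insert _ _))) hbe'
        rwa [sub_sub_cancel] at this
      · by_cases hyb : y = b - e
        · rw [hyb]; exact hbe'
        · refine hE₁ (hD₁ (subset_acl _ (Or.inr ⟨hy, ?_⟩)))
          simp [hye, hyb]
  · exact acl_mono (Set.insert_subset_insert (Set.subset_union_left.trans (subset_acl _)))

theorem exists_le [IsAlgClosed F] (hE : IsCoeffField O E) (S : Finset F)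
    (hS : ∀ x ∈ acl k (S : Set F), x ∈ O) :
    ∃ E' : IntermediateField k F, IsCoeffField O E' ∧ acl k (S : Set F) ≤ E' := by
  classical
  induction S using Finset.induction_on with
  | empty => exact ⟨E, hE, acl_le hE.isRelClosed (by simp)⟩
  | insert b S _ ih =>
    rw [Finset.coe_insert] at hS ⊢
    obtain ⟨E₁, hE₁, hle⟩ := ih fun x hx => hS x (acl_mono (Set.subset_insert _ _) hx)
    rw [← acl_insert_acl] at hS ⊢
    exact hE₁.exists_insert hle hS

end IsCoeffField

end CoefficientFields

/-! ### Conjugating valuation rings over a subfield. -/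

section Conjugation

open ValuationSubring Pointwise

variable {k F : Type*} [Field k] [Field F] [Algebra k F]

theorem ValuationSubring.mem_smul_iff {O : ValuationSubring F} {σ : F ≃ₐ[k] F} {x : F} :
    x ∈ σ • O ↔ σ.symm x ∈ O :=
  mem_pointwise_smul_iff_inv_smul_mem

theorem IsCoeffField.smul {O : ValuationSubring F} {E : IntermediateField k F}
    (hE : IsCoeffField O E) (σ : F ≃ₐ[k] F) :
    IsCoeffField (σ • O) (acl k (σ '' (E : Set F))) := by
  obtain ⟨h, hh, hs⟩ := hE.exists_spanning
  have himg : ∀ x ∈ acl k (σ '' (E : Set F)), σ.symm x ∈ E := fun x hx => by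
    rw [← SetLike.mem_coe, ← image_acl, hE.isRelClosed.acl_eq] at hx
    obtain ⟨y, hy, rfl⟩ := hx
    simpa using hy
  refine ⟨isRelClosed_acl _, fun x hx => mem_smul_iff.2 (hE.mem_of_mem _ (himg x hx)), σ h,
    fun h' => hh (by simpa using mem_smul_iff.1 h'), fun x => ?_⟩
  have := map_mem_acl_image σ (hs (σ.symm x))
  rw [Set.image_insert_eq, AlgEquiv.apply_symm_apply] at this
  exact acl_mono (Set.insert_subset_insert (subset_acl _)) this

/-- After removing the largest power of `t`, what remains has a nonzero constant term in `E`, a unit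
to which the other terms add an element of the maximal ideal. -/
theorem ValuationSubring.valuation_aeval {O : ValuationSubring F} {E : IntermediateField k F}
    (hE : ∀ x ∈ E, x ∈ O) {t : F} (ht : O.valuation t < 1) {p : Polynomial E} (hp : p ≠ 0) :
    O.valuation (Polynomial.aeval t p) = O.valuation t ^ p.rootMultiplicity 0 := by
  obtain ⟨q, hq, hdvd⟩ := p.exists_eq_pow_rootMultiplicity_mul_and_not_dvd hp 0
  set n := p.rootMultiplicity 0
  rw [hq, map_mul, map_mul, map_pow, map_pow]
  rw [map_zero, sub_zero] at hdvd ⊢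
  rw [Polynomial.aeval_X]
  rw [Polynomial.X_dvd_iff] at hdvd
  have h1 : O.valuation (q.coeff 0 : F) = 1 :=
    valuation_eq_one_of_mem_field hE (q.coeff 0).2 (by simpa using hdvd)
  have h2 : ∀ r : Polynomial E, Polynomial.aeval t r ∈ O := fun r => by
    rw [Polynomial.aeval_eq_sum_range]
    refine O.toSubring.sum_mem fun i _ => ?_
    rw [Algebra.smul_def]
    exact O.mul_mem _ _ (hE _ (r.coeff i).2) (O.toSubring.pow_mem (mem_of_valuation_lt_one ht) _)
  have h3 : O.valuation (Polynomial.aeval t q) = 1 := by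
    have h4 : O.valuation (Polynomial.aeval t q.divX * t) < O.valuation (q.coeff 0 : F) := by
      rw [h1, mul_comm, map_mul]
      exact mul_lt_one_of_lt_of_le ht ((O.valuation_le_one_iff _).2 (h2 _))
    conv_lhs => rw [← q.divX_mul_X_add]
    rw [map_add, map_mul, Polynomial.aeval_X, Polynomial.aeval_C]
    exact (Valuation.map_add_eq_of_lt_right _ h4).trans h1
  rw [h3, mul_one]

/-- A valuation ring with coefficient field `E ⊇ A` not containing `h` is determined on the field
generated by `E`, `h` and `T`. -/
def DeterminesValuation (A : IntermediateField k F) (h : F) (T : Set F) : Prop :=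
  ∀ (O O' : ValuationSubring F) (E : IntermediateField k F), A ≤ E → IsCoeffField O E →
    IsCoeffField O' E → h ∉ O → h ∉ O' →
      ∀ x ∈ IntermediateField.adjoin k (insert h ((E : Set F) ∪ T)), x ∈ O → x ∈ O'

/-- On `E(h⁻¹)` any such valuation is the order of vanishing in `h⁻¹`. -/
theorem determinesValuation_empty (A : IntermediateField k F) (h : F) :
    DeterminesValuation A h ∅ := by
  intro O O' E _ hE hE' hh hh' x hx hxO
  rw [Set.union_empty, ← Set.union_singleton, ← IntermediateField.restrictScalars_adjoin] at hx
  have h0 : h ≠ 0 := by rintro rfl; exact hh O.zero_mem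
  have hadj : IntermediateField.adjoin E {h} ≤ IntermediateField.adjoin E {h⁻¹} := by
    rw [IntermediateField.adjoin_simple_le_iff]
    exact inv_mem_iff.1 (IntermediateField.mem_adjoin_simple_self E h⁻¹)
  obtain ⟨r, s, rfl⟩ := IntermediateField.mem_adjoin_simple_iff E x |>.1 (hadj hx)
  by_cases hr : r = 0
  · simp [hr]
  by_cases hs : s = 0
  · simp [hs]
  have key : ∀ {V : ValuationSubring F}, IsCoeffField V E → h ∉ V →
      (Polynomial.aeval h⁻¹ r / Polynomial.aeval h⁻¹ s ∈ V ↔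
        s.rootMultiplicity 0 ≤ r.rootMultiplicity 0) := fun {V} hV hh => by
    have hv := valuation_inv_lt_one hh
    have h0' : 0 < V.valuation h⁻¹ := by rw [zero_lt_iff]; simpa using h0
    rw [← V.valuation_le_one_iff, map_div₀, valuation_aeval hV.mem_of_mem hv hr,
      valuation_aeval hV.mem_of_mem hv hs, div_le_one₀ (pow_pos h0' _),
      pow_le_pow_iff_right_of_lt_one₀ h0' hv]
  exact (key hE' hh').2 ((key hE hh).1 hxO)

variable [IsAlgClosed F]

theorem exists_algEquiv_fixing_apply_eq {A : IntermediateField k F} (hA : IsRelClosed A) {b z : F}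
    (hb : b ∉ A) (hz : z ∉ A) : ∃ σ : F ≃ₐ[k] F, (∀ x ∈ A, σ x = x) ∧ σ b = z := by
  obtain ⟨σ, hσ⟩ := exists_algEquiv_apply_eq (hA.notMem_iff_transcendental.1 hb)
    (hA.notMem_iff_transcendental.1 hz)
  exact ⟨σ.restrictScalars k, fun x hx => σ.commutes ⟨x, hx⟩, hσ⟩

variable [CharZero k]

theorem exists_algEquiv_smul_eq {A : IntermediateField k F} {O₁ O₂ : ValuationSubring F}
    {E₁ E₂ : IntermediateField k F} (hE₁ : IsCoeffField O₁ E₁)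
    (hE₂ : IsCoeffField O₂ E₂) (hAE₁ : A ≤ E₁) (hAE₂ : A ≤ E₂) {h : F} (hh₁ : h ∉ O₁)
    (hh₂ : h ∉ O₂) {T : Set F} (hT : T ⊆ acl k (insert h (A : Set F)))
    (hdet : DeterminesValuation A h T) :
    ∃ ρ : F ≃ₐ[k] F, (∀ x ∈ A, ρ x = x) ∧ ρ h = h ∧ (∀ x ∈ T, ρ x = x) ∧ ρ • O₁ = O₂ := by
  set B := acl k (insert h (A : Set F))
  have hAB : (A : Set F) ⊆ B := (Set.subset_insert _ _).trans (subset_acl _)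
  have hhB : h ∈ B := subset_acl _ (Set.mem_insert _ _)
  have key : ∀ {O : ValuationSubring F} {E : IntermediateField k F}, IsCoeffField O E → A ≤ E →
      h ∉ O → ∃ Y ⊆ (E : Set F), IsTranscendenceBasis B ((↑) : Y → F) ∧
        E = acl k ((A : Set F) ∪ Y) := by
    intro O E hE hAE hh
    have hhE : h ∉ E := fun h' => hh (hE.mem_of_mem h h')
    have : Algebra.IsAlgebraic (Algebra.adjoin B (E : Set F)) F := by
      refine ⟨fun x => ?_⟩
      have hx : x ∈ acl k ((B : Set F) ∪ (E : Set F)) := by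
        refine acl_mono ?_ (hE.mem_acl_insert hhE x)
        exact Set.insert_subset (Or.inl hhB) Set.subset_union_right
      exact IntermediateField.isAlgebraic_adjoin_iff.1 (mem_acl.1 (mem_acl_union_iff.1 hx))
    obtain ⟨Y, hYE, hY⟩ := exists_isTranscendenceBasis_subset (R := B) (E : Set F)
    refine ⟨Y, hYE, hY, le_antisymm (fun x hx => ?_) ?_⟩
    · by_contra hcon
      have hx' : x ∈ acl B Y := by
        rw [mem_acl_iff_mem_closure, (AlgebraicIndependent.matroid_isBase_iff.2 hY).closure_eq]
        trivial
      rw [← mem_acl_union_iff] at hx'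
      -- An `x ∈ E` outside `acl(A, Y)` could be exchanged with `h`, putting the pole `h` into `E`.
      have h1 : x ∈ acl k (insert h ((A : Set F) ∪ Y)) := by
        refine acl_le_acl (Set.union_subset ?_ ?_) hx'
        · exact acl_mono (Set.insert_subset_insert Set.subset_union_left)
        · exact (Set.subset_union_right.trans (Set.subset_insert _ _)).trans (subset_acl _)
      refine hhE (acl_le hE.isRelClosed ?_ (acl_exchange h1 hcon))
      exact Set.insert_subset hx (Set.union_subset hAE hYE)
    · exact acl_le hE.isRelClosed (Set.union_subset hAE hYE)
  obtain ⟨Y₁, -, hY₁, hEY₁⟩ := key hE₁ hAE₁ hh₁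
  obtain ⟨Y₂, -, hY₂, hEY₂⟩ := key hE₂ hAE₂ hh₂
  obtain ⟨e⟩ := Cardinal.eq.1 (hY₁.cardinalMk_eq hY₂)
  obtain ⟨ρ₁, hρ₁⟩ := IsAlgClosed.exists_ringEquiv_of_isTranscendenceBasis e hY₁ hY₂
  set ρ₀ : F ≃ₐ[k] F := ρ₁.restrictScalars k
  have hρB : ∀ x ∈ B, ρ₀ x = x := fun x hx => ρ₁.commutes ⟨x, hx⟩
  have himg : acl k ((A : Set F) ∪ Y₂) ≤ acl k (ρ₀ '' (E₁ : Set F)) := by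
    refine acl_mono (Set.union_subset (fun x hx => ⟨x, hAE₁ hx, hρB x (hAB hx)⟩) fun y hy => ?_)
    refine ⟨e.symm ⟨y, hy⟩, ?_, ?_⟩
    · rw [hEY₁]; exact subset_acl _ (Or.inr (e.symm ⟨y, hy⟩).2)
    · have := hρ₁ (e.symm ⟨y, hy⟩)
      rwa [Equiv.apply_symm_apply] at this
  have hρh : h ∉ ρ₀ • O₁ := fun h' => hh₁ (by
    rwa [mem_smul_iff, show ρ₀.symm h = h by rw [AlgEquiv.symm_apply_eq, hρB h hhB]] at h')
  have hE₂' : IsCoeffField (ρ₀ • O₁) E₂ :=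
    ⟨hE₂.isRelClosed, fun x hx => (hE₁.smul ρ₀).mem_of_mem x (himg (hEY₂ ▸ hx)), h, hρh,
      hE₂.mem_acl_insert fun h' => hh₂ (hE₂.mem_of_mem h h')⟩
  set M := IntermediateField.adjoin k (insert h ((E₂ : Set F) ∪ T))
  have hM : insert h ((E₂ : Set F) ∪ T) ⊆ M := IntermediateField.subset_adjoin _ _
  have : Algebra.IsAlgebraic M F := isAlgebraic_of_forall_mem_acl fun x => by
    refine acl_mono ?_ (hE₂.mem_acl_insert (fun h' => hh₂ (hE₂.mem_of_mem h h')) x)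
    exact (Set.insert_subset_insert Set.subset_union_left).trans hM
  have : IsAlgClosure M F := ⟨inferInstance, inferInstance⟩
  have : CharZero M := charZero_of_injective_algebraMap (algebraMap k M).injective
  have : IsGalois M F := inferInstance
  -- Both rings now have coefficient field `E₂` and a pole at `h`, so `hdet`, applied in both
  -- directions, makes them agree on `M`.
  obtain ⟨τ, hτ⟩ := ValuationSubring.exists_smul_eq_of_agree (K := M) (O := ρ₀ • O₁) (O' := O₂)
    fun x => ⟨hdet _ _ _ hAE₂ hE₂' hE₂ hρh hh₂ x x.2, hdet _ _ _ hAE₂ hE₂ hE₂' hh₂ hρh x x.2⟩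
  have hτM : ∀ x ∈ M, τ x = x := fun x hx => τ.commutes ⟨x, hx⟩
  refine ⟨ρ₀.trans (τ.restrictScalars k), fun x hx => ?_, ?_, fun x hx => ?_, ?_⟩
  · change τ (ρ₀ x) = x
    rw [hρB x (hAB hx), hτM x (hM (Set.mem_insert_of_mem _ (Or.inl (hAE₂ hx))))]
  · change τ (ρ₀ h) = h
    rw [hρB h hhB, hτM h (hM (Set.mem_insert _ _))]
  · change τ (ρ₀ x) = x
    rw [hρB x (hT hx), hτM x (hM (Set.mem_insert_of_mem _ (Or.inr hx)))]
  · rw [← hτ]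
    ext x
    rw [mem_smul_iff, mem_smul_iff, mem_smul_iff]
    rfl

/-- Pull `O₂` back along `σ`, conjugate while fixing `A`, `h` and `T`, and compose with `σ`. -/
theorem exists_algEquiv_smul_eq_of_apply {A : IntermediateField k F}
    {O₁ O₂ : ValuationSubring F} {E₁ E₂ : IntermediateField k F} (hE₁ : IsCoeffField O₁ E₁)
    (hE₂ : IsCoeffField O₂ E₂) (hAE₁ : A ≤ E₁) (σ : F ≃ₐ[k] F) (hAE₂ : ∀ x ∈ A, σ x ∈ E₂)
    {h : F} (hh₁ : h ∉ O₁) (hh₂ : σ h ∉ O₂) {T : Set F}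
    (hT : T ⊆ acl k (insert h (A : Set F))) (hdet : DeterminesValuation A h T) :
    ∃ g : F ≃ₐ[k] F, (∀ x ∈ A, g x = σ x) ∧ g h = σ h ∧ (∀ x ∈ T, g x = σ x) ∧ g • O₁ = O₂ := by
  obtain ⟨ρ, h1, h2, h3, h4⟩ := exists_algEquiv_smul_eq hE₁ (hE₂.smul σ⁻¹) hAE₁
    (fun x hx => subset_acl _ ⟨σ x, hAE₂ x hx, σ.symm_apply_apply x⟩) hh₁
    (fun h' => hh₂ (mem_smul_iff.1 h')) hT hdet
  refine ⟨σ * ρ, fun x hx => congrArg σ (h1 x hx), congrArg σ h2, fun x hx => congrArg σ (h3 x hx),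
    ?_⟩
  rw [mul_smul, h4, smul_inv_smul]

/-- Elements congruent modulo the maximal ideal are conjugate under the decomposition group. -/
theorem IsCoeffField.exists_apply_eq_of_congr {O : ValuationSubring F} {E : IntermediateField k F}
    (hE : IsCoeffField O E) (S : Finset F) (hS : ∀ x ∈ acl k (S : Set F), x ∈ O) {b z : F}
    (hb : b ∉ acl k (S : Set F)) (hz : z ∉ acl k (S : Set F)) (hbz : O.valuation (z - b) < 1) :
    ∃ g ∈ O.decompositionSubgroup k, (∀ x ∈ acl k (S : Set F), g x = x) ∧ g b = z := by
  classical
  obtain ⟨E₁, hE₁, hle⟩ := hE.exists_le S hS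
  set A := acl k (S : Set F)
  have hAc : IsRelClosed A := isRelClosed_acl _
  have hzb := mem_of_valuation_lt_one hbz
  -- Three cases: `b` is itself a pole; `b` is congruent to some `c ∈ A`, and `(b - c)⁻¹` is a pole;
  -- or the residue of `b` is transcendental over that of `A`, and `b`, `z` are absorbed into
  -- coefficient fields while an unrelated pole `h` is fixed.
  by_cases hbO : b ∈ O
  swap
  · obtain ⟨σ, hσ, hσb⟩ := exists_algEquiv_fixing_apply_eq hAc hb hz
    have hzO : z ∉ O := fun h => hbO (by simpa using O.toSubring.sub_mem h hzb)
    obtain ⟨g, hg, hgb, -, hgO⟩ := exists_algEquiv_smul_eq_of_apply hE₁ hE₁ hle σ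
      (fun x hx => hle (by rwa [hσ x hx])) hbO (by rwa [hσb]) (Set.empty_subset _)
      (determinesValuation_empty A b)
    exact ⟨g, hgO, fun x hx => (hg x hx).trans (hσ x hx), hgb.trans hσb⟩
  by_cases hc : ∃ c ∈ A, O.valuation (b - c) < 1
  · obtain ⟨c, hcA, hc⟩ := hc
    obtain ⟨σ, hσ, hσb⟩ := exists_algEquiv_fixing_apply_eq hAc hb hz
    have hzc : O.valuation (z - c) < 1 := by
      rw [← sub_add_sub_cancel z b c]; exact Valuation.map_add_lt _ hbz hc
    have hbc0 : b - c ≠ 0 := sub_ne_zero.2 fun h => hb (h ▸ hcA)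
    have hzc0 : z - c ≠ 0 := sub_ne_zero.2 fun h => hz (h ▸ hcA)
    have hσh : σ (b - c)⁻¹ = (z - c)⁻¹ := by rw [map_inv₀, map_sub, hσb, hσ c hcA]
    obtain ⟨g, hg, hgb, -, hgO⟩ := exists_algEquiv_smul_eq_of_apply hE₁ hE₁ hle σ
      (fun x hx => hle (by rwa [hσ x hx])) (inv_notMem_of_valuation_lt_one hbc0 hc)
      (by rw [hσh]; exact inv_notMem_of_valuation_lt_one hzc0 hzc) (Set.empty_subset _)
      (determinesValuation_empty A _)
    refine ⟨g, hgO, fun x hx => (hg x hx).trans (hσ x hx), ?_⟩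
    rw [hσh, map_inv₀, inv_inj, map_sub, hg c hcA, hσ c hcA] at hgb
    exact sub_left_injective hgb
  · push Not at hc
    have hb1 : ∀ a ∈ A, O.valuation (b - a) = 1 := fun a ha => le_antisymm
      ((O.valuation_le_one_iff _).2 (O.toSubring.sub_mem hbO (hS a ha))) (hc a ha)
    have hz1 : ∀ a ∈ A, O.valuation (z - a) = 1 := fun a ha => by
      rw [← sub_add_sub_cancel z b a, Valuation.map_add_eq_of_lt_right _ (by rwa [hb1 a ha]),
        hb1 a ha]
    obtain ⟨h, hh, -⟩ := hE.exists_spanning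
    have hOf : ∀ {y : F}, (∀ a ∈ A, O.valuation (y - a) = 1) →
        ∀ x ∈ acl k (insert y (A : Set F)), x ∈ O := fun hy x hx =>
      acl_insert_subset hAc hS hy hx
    have hnot : ∀ {y : F}, (∀ a ∈ A, O.valuation (y - a) = 1) → y ∉ A →
        y ∉ acl k (insert h (A : Set F)) := fun hy hyA hcon =>
      hh (hOf hy h (acl_exchange hcon (by rwa [hAc.acl_eq])))
    obtain ⟨σ, hσ, hσb⟩ := exists_algEquiv_fixing_apply_eq (isRelClosed_acl _) (hnot hb1 hb)
      (hnot hz1 hz)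
    have hσA : ∀ x ∈ A, σ x = x := fun x hx =>
      hσ x (subset_acl _ (Set.mem_insert_of_mem _ hx))
    have hσh : σ h = h := hσ h (subset_acl _ (Set.mem_insert _ _))
    have hex : ∀ {y : F}, (∀ a ∈ A, O.valuation (y - a) = 1) →
        ∃ E', IsCoeffField O E' ∧ acl k (insert y (A : Set F)) ≤ E' := fun {y} hy => by
      have := hE.exists_le (insert y S)
      rw [Finset.coe_insert, ← acl_insert_acl] at this
      exact this (hOf hy)
    obtain ⟨E₂, hE₂, hle₂⟩ := hex hb1
    obtain ⟨E₃, hE₃, hle₃⟩ := hex hz1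
    obtain ⟨g, hg, -, -, hgO⟩ := exists_algEquiv_smul_eq_of_apply hE₂ hE₃ hle₂ σ
      (fun x hx => hle₃ (by
        have := map_mem_acl_image σ hx
        rw [Set.image_insert_eq, hσb] at this
        refine acl_mono (Set.insert_subset_insert ?_) this
        rintro _ ⟨a, ha, rfl⟩
        rwa [hσA a ha])) hh (by rwa [hσh]) (Set.empty_subset _) (determinesValuation_empty _ h)
    have hAb : (A : Set F) ⊆ acl k (insert b (A : Set F)) :=
      (Set.subset_insert _ _).trans (subset_acl _)
    exact ⟨g, hgO, fun x hx => (hg x (hAb hx)).trans (hσA x hx),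
      (hg b (subset_acl _ (Set.mem_insert _ _))).trans hσb⟩

end Conjugation

/-! ### Polynomial approximations to Hensel roots. -/

section HenselApproximation

open Polynomial

variable {A : Type*} [Field A]

theorem Polynomial.eval_zero_eval (f : A[X][X]) (p : A[X]) :
    (f.eval p).eval 0 = (f.map (evalRingHom 0)).eval (p.eval 0) := by
  rw [eval_map]
  exact (eval₂_at_apply (evalRingHom 0) p).symm

/-- Polynomial approximations of the power series root of `f` lifting a simple root `c` of
`f(0, Y)`. -/
theorem Polynomial.exists_pow_dvd_eval {f : A[X][X]} {c : A}
    (h0 : (f.map (evalRingHom 0)).eval c = 0)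
    (h1 : (f.map (evalRingHom 0)).derivative.eval c ≠ 0) (N : ℕ) :
    ∃ p : A[X], p.eval 0 = c ∧ X ^ N ∣ f.eval p := by
  suffices h : ∀ n : ℕ, ∃ p : A[X], p.eval 0 = c ∧ X ^ (n + 1) ∣ f.eval p by
    obtain ⟨p, hp, hdvd⟩ := h N
    exact ⟨p, hp, (pow_dvd_pow _ N.le_succ).trans hdvd⟩
  intro n
  induction n with
  | zero =>
    refine ⟨C c, eval_C, ?_⟩
    rw [zero_add, pow_one, X_dvd_iff, coeff_zero_eq_eval_zero, eval_zero_eval, eval_C, h0]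
  | succ n ih =>
    obtain ⟨p, hp, q, hq⟩ := ih
    set b := (f.map (evalRingHom 0)).derivative.eval c
    obtain ⟨r, hr⟩ := f.binomExpansion p (C (-(q.eval 0) / b) * X ^ (n + 1))
    refine ⟨p + C (-(q.eval 0) / b) * X ^ (n + 1), by simp [hp], ?_⟩
    have hX : X ∣ q + f.derivative.eval p * C (-(q.eval 0) / b) := by
      rw [X_dvd_iff, coeff_zero_eq_eval_zero, eval_add, eval_mul, eval_zero_eval, hp, eval_C,
        ← derivative_map, mul_div_cancel₀ _ h1, add_neg_cancel]
    rw [hr, hq]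
    have : X ^ (n + 1) * q + f.derivative.eval p * (C (-(q.eval 0) / b) * X ^ (n + 1)) +
        r * (C (-(q.eval 0) / b) * X ^ (n + 1)) ^ 2 =
        X ^ (n + 1) * (q + f.derivative.eval p * C (-(q.eval 0) / b)) +
          X ^ (n + 1 + 1) * (X ^ n * (r * C (-(q.eval 0) / b) ^ 2)) := by ring
    rw [this]
    refine dvd_add ?_ (Dvd.intro _ rfl)
    rw [pow_succ]
    exact mul_dvd_mul_left _ hX

variable {B : Type*} [CommRing B] [IsLocalRing B] {g : A[X] →+* B}

theorem Polynomial.map_mem_maximalIdeal (hg : g X ∈ IsLocalRing.maximalIdeal B) {q : A[X]}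
    (hq : q.eval 0 = 0) : g q ∈ IsLocalRing.maximalIdeal B := by
  rw [← coeff_zero_eq_eval_zero, ← X_dvd_iff] at hq
  obtain ⟨r, rfl⟩ := hq
  rw [map_mul]
  exact Ideal.mul_mem_right _ _ hg

theorem Polynomial.isUnit_map_of_eval_ne_zero (hg : g X ∈ IsLocalRing.maximalIdeal B) {q : A[X]}
    (hq : q.eval 0 ≠ 0) : IsUnit (g q) := by
  by_contra hcon
  have h1 := Ideal.sub_mem _ ((IsLocalRing.mem_maximalIdeal _).2 hcon)
    (map_mem_maximalIdeal hg (q := q - C (q.eval 0)) (by simp))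
  rw [map_sub, sub_sub_cancel] at h1
  exact (IsLocalRing.mem_maximalIdeal _).1 h1 (((isUnit_iff_ne_zero.2 hq).map C).map g)

/-- Taylor expansion at `p` writes `-f(p)` as `y - p` times a unit, the derivative being a unit at
the simple root `c`. So `y - p` is as divisible as `f(p)`. -/
theorem Polynomial.pow_dvd_sub_map (hg : g X ∈ IsLocalRing.maximalIdeal B) {f : A[X][X]} {y : B}
    (hy : f.eval₂ g y = 0) {c : A} (h1 : (f.map (evalRingHom 0)).derivative.eval c ≠ 0)
    (hyc : y - g (C c) ∈ IsLocalRing.maximalIdeal B) {p : A[X]} (hp : p.eval 0 = c) {N : ℕ}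
    (hdvd : X ^ N ∣ f.eval p) : g X ^ N ∣ y - g p := by
  have hδ : y - g p ∈ IsLocalRing.maximalIdeal B := by
    have := Ideal.sub_mem _ hyc (map_mem_maximalIdeal hg (q := p - C c) (by simp [hp]))
    rwa [map_sub, sub_sub_sub_cancel_right] at this
  obtain ⟨r, hr⟩ := (f.map g).binomExpansion (g p) (y - g p)
  rw [add_sub_cancel, eval_map, hy, eval_map, eval₂_at_apply, derivative_map, eval_map,
    eval₂_at_apply] at hr
  have hunit : IsUnit (g (f.derivative.eval p) + r * (y - g p)) := by
    by_contra hcon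
    have := Ideal.sub_mem _ ((IsLocalRing.mem_maximalIdeal _).2 hcon)
      (Ideal.mul_mem_left _ r hδ)
    rw [add_sub_cancel_right] at this
    refine (IsLocalRing.mem_maximalIdeal _).1 this (isUnit_map_of_eval_ne_zero hg ?_)
    rwa [eval_zero_eval, hp, ← derivative_map]
  rw [← hunit.dvd_mul_right]
  have h2 : (y - g p) * (g (f.derivative.eval p) + r * (y - g p)) = - g (f.eval p) := by
    linear_combination -hr
  rw [h2, dvd_neg, ← map_pow]
  exact _root_.map_dvd g hdvd

theorem Polynomial.exists_root_sub_mem_maximalIdeal (hg : g X ∈ IsLocalRing.maximalIdeal B)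
    {f : A[X][X]} (hf : f.Monic) (hsplits : (f.map (evalRingHom 0)).Splits) {y : B}
    (hy : f.eval₂ g y = 0) :
    ∃ c ∈ (f.map (evalRingHom 0)).roots, y - g (C c) ∈ IsLocalRing.maximalIdeal B := by
  let res := IsLocalRing.residue B
  have hgC : res.comp g = ((res.comp g).comp C).comp (evalRingHom 0) := by
    refine Polynomial.ringHom_ext (fun a => by simp) ?_
    simpa [res, IsLocalRing.residue_eq_zero_iff] using hg
  have h1 : (f.map (evalRingHom 0)).eval₂ ((res.comp g).comp C) (res y) = 0 := by
    rw [eval₂_map, ← hgC, ← hom_eval₂, hy, map_zero]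
  rw [hsplits.eq_prod_roots_of_monic (hf.map _), eval₂_multiset_prod, Multiset.map_map,
    Multiset.prod_eq_zero_iff, Multiset.mem_map] at h1
  obtain ⟨c, hc, hcy⟩ := h1
  refine ⟨c, hc, ?_⟩
  rw [← IsLocalRing.residue_eq_zero_iff, map_sub]
  simpa using hcy

end HenselApproximation

/-! ### A function with its only pole at one point of a curve. -/

section Localizing

open Polynomial

/-- If `y` were larger than all coefficients and than `1`, its leading power would dominate the
monic equation. -/
theorem Valuation.le_of_eval₂_eq_zero {R K Γ₀ : Type*} [CommRing R] [Field K]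
    [LinearOrderedCommGroupWithZero Γ₀] (v : Valuation K Γ₀) {φ : R →+* K} {f : R[X]}
    (hf : f.Monic) {y : K} (hy : f.eval₂ φ y = 0) {c : Γ₀} (hc : 1 ≤ c)
    (h : ∀ j, v (φ (f.coeff j)) ≤ c) : v y ≤ c := by
  by_contra! hlt
  have h1 : 1 < v y := hc.trans_lt hlt
  have h0 : 0 < v y := zero_lt_one.trans h1
  have h2 : y ^ f.natDegree =
      -∑ j ∈ Finset.range f.natDegree, φ (f.coeff j) * y ^ j := by
    rw [eval₂_eq_sum_range, Finset.sum_range_succ, hf.coeff_natDegree, map_one, one_mul] at hy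
    linear_combination hy
  have h3 : v (y ^ f.natDegree) < v y ^ f.natDegree := by
    rw [h2, Valuation.map_neg]
    refine v.map_sum_lt (pow_pos h0 _).ne' fun j hj => ?_
    calc v (φ (f.coeff j) * y ^ j) = v (φ (f.coeff j)) * v y ^ j := by rw [map_mul, map_pow]
      _ < v y * v y ^ j := mul_lt_mul_of_pos_right ((h j).trans_lt hlt) (pow_pos h0 j)
      _ = v y ^ (j + 1) := (pow_succ' _ _).symm
      _ ≤ v y ^ f.natDegree := pow_le_pow_right₀ h1.le (Finset.mem_range.1 hj)
  rw [map_pow] at h3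
  exact h3.false

variable {A F : Type*} [Field A] [Field F] [Algebra A F]

theorem ValuationSubring.valuation_aeval_le {O : ValuationSubring F}
    (hO : ∀ a : A, algebraMap A F a ∈ O) {t : F} {q : A[X]} {c : O.ValueGroup}
    (hc : ∀ i ≤ q.natDegree, O.valuation t ^ i ≤ c) : O.valuation (aeval t q) ≤ c := by
  rw [aeval_eq_sum_range]
  refine O.valuation.map_sum_le fun i hi => ?_
  rw [Algebra.smul_def, map_mul, map_pow]
  refine (mul_le_of_le_one_left' ((O.valuation_le_one_iff _).2 (hO _))).trans (hc i ?_)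
  exact Nat.lt_succ_iff.1 (Finset.mem_range.1 hi)

/-- On the curve `f(t, y) = 0` the fibre over `t = 0` consists of `d + 1` distinct points. Take `h =
P(t, y) / t ^ D` with `P` of controlled growth at the poles of `t` and vanishing to order `D` at
every point of the fibre but one. Linear algebra finds a nonconstant `h` of this kind. -/
theorem exists_notMem_range_forall_valuation_lt_one [IsAlgClosed A] {t y : F} (ht : t ≠ 0)
    {f : A[X][X]} (hf : f.Monic) (hy : f.eval₂ (aeval t : A[X] →ₐ[A] F).toRingHom y = 0)
    (hmin : ∀ g : A[X][X], g.degree < f.degree →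
      g.eval₂ (aeval t : A[X] →ₐ[A] F).toRingHom y = 0 → g = 0)
    (hsep : (f.map (evalRingHom 0)).Separable) :
    ∃ h ∈ IntermediateField.adjoin A {t, y}, h ∉ (algebraMap A F).range ∧
      ∃ c : A, (f.map (evalRingHom 0)).IsRoot c ∧ ∀ O : ValuationSubring F,
        (∀ a : A, algebraMap A F a ∈ O) → h ∉ O →
          O.valuation t < 1 ∧ O.valuation (y - algebraMap A F c) < 1 := by
  classical
  set φ : A[X] →+* F := (aeval t : A[X] →ₐ[A] F).toRingHom with hφ
  have hφa : ∀ q, φ q = aeval t q := fun q => rfl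
  have hφX : φ X = t := aeval_X t
  have hφC : ∀ a, φ (C a) = algebraMap A F a := fun a => aeval_C t a
  set f₀ := f.map (evalRingHom 0) with hf₀
  have hf₀m : f₀.Monic := hf.map _
  obtain ⟨d, hd⟩ : ∃ d, f.natDegree = d + 1 := Nat.exists_eq_succ_of_ne_zero fun h => by
    rw [eq_one_of_monic_natDegree_zero hf h, eval₂_one] at hy
    exact one_ne_zero hy
  have hcard : f₀.roots.toFinset.card = d + 1 := by
    rw [Multiset.toFinset_card_of_nodup (nodup_roots hsep),
      ← (IsAlgClosed.splits f₀).natDegree_eq_card_roots, hf.natDegree_map, hd]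
  obtain ⟨c₁, hc₁⟩ : f₀.roots.toFinset.Nonempty := by
    rw [← Finset.card_pos, hcard]; exact d.succ_pos
  have hroot : ∀ {c}, c ∈ f₀.roots.toFinset → f₀.eval c = 0 := fun hc =>
    (mem_roots hf₀m.ne_zero).1 (Multiset.mem_toFinset.1 hc)
  obtain ⟨e, he⟩ : ∃ e, ∀ j, (f.coeff j).natDegree ≤ e := by
    refine ⟨f.support.sup fun j => (f.coeff j).natDegree, fun j => ?_⟩
    by_cases hj : j ∈ f.support
    · exact Finset.le_sup (f := fun j => (f.coeff j).natDegree) hj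
    · rw [notMem_support_iff.1 hj]; simp
  -- The candidates have dimension `(d + 1)(N + 1)` and there are `d D` vanishing conditions. With
  -- this `N` the kernel has dimension at least `d + 2`, so it is not mapped into the line spanned
  -- by `t ^ D`.
  set N := e * d * d + 1 with hN
  set D := N + e * d with hD
  have hder : ∀ {c}, c ∈ f₀.roots.toFinset → f₀.derivative.eval c ≠ 0 := fun hc =>
    hsep.aeval_derivative_ne_zero (x := _) (hroot hc)
  have hp : ∀ c : {c // c ∈ f₀.roots.toFinset.erase c₁}, ∃ p : A[X], p.eval 0 = c ∧
      X ^ D ∣ f.eval p := fun c => exists_pow_dvd_eval (hroot (Finset.mem_of_mem_erase c.2))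
        (hder (Finset.mem_of_mem_erase c.2)) D
  choose p hp0 hpD using hp
  let W := Fin (d + 1) → degreeLT A (N + 1)
  have hadd : ∀ (r s : W) j, ((r + s) j : A[X]) = r j + s j := fun _ _ _ => rfl
  have hsmul : ∀ (a : A) (r : W) j, ((a • r) j : A[X]) = a • (r j : A[X]) := fun _ _ _ => rfl
  -- Where `t` has value at least `1`, `y` is bounded by `t ^ e`. The weight `e (d - j)` therefore
  -- bounds every term by `t ^ D`.
  let P : W → A[X][X] := fun r => ∑ j, C ((r j : A[X]) * X ^ (e * (d - j))) * X ^ (j : ℕ)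
  have hPdeg : ∀ r, (P r).degree < f.degree := fun r => by
    rw [degree_eq_natDegree hf.ne_zero, hd]
    refine (degree_sum_le _ _).trans_lt ((Finset.sup_lt_iff (WithBot.bot_lt_coe _)).2 fun j _ => ?_)
    exact (degree_C_mul_X_pow_le _ _).trans_lt (WithBot.coe_lt_coe.2 (by exact_mod_cast j.2))
  have hPcoeff : ∀ r (j : Fin (d + 1)), (P r).coeff j = (r j : A[X]) * X ^ (e * (d - j)) := by
    intro r j
    simp only [P, finsetSum_coeff, coeff_C_mul, coeff_X_pow, Fin.val_inj, mul_ite, mul_one,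
      mul_zero, Finset.sum_ite_eq, Finset.mem_univ, if_true]
  let ev : W →ₗ[A] F :=
    { toFun := fun r => ∑ j, aeval t ((r j : A[X]) * X ^ (e * (d - j))) * y ^ (j : ℕ)
      map_add' := fun r s => by
          simp only [hadd, add_mul, map_add, Finset.sum_add_distrib]
      map_smul' := fun a r => by
          simp only [hsmul, smul_mul_assoc, map_smul, Finset.smul_sum, RingHom.id_apply] }
  have hevdef : ∀ r, ev r =
      ∑ j, aeval t ((r j : A[X]) * X ^ (e * (d - j))) * y ^ (j : ℕ) := fun _ => rfl
  have hev : ∀ r, ev r = (P r).eval₂ φ y := fun r => by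
    simp only [P, eval₂_finsetSum, eval₂_mul, eval₂_C, eval₂_X_pow]
    rfl
  let con : W →ₗ[A] ({c // c ∈ f₀.roots.toFinset.erase c₁} → Fin D → A) :=
    LinearMap.pi fun c => LinearMap.pi fun i => lcoeff A i ∘ₗ
      { toFun := fun r => ∑ j, ((r j : A[X]) * X ^ (e * (d - j))) * p c ^ (j : ℕ)
        map_add' := fun r s => by
          simp only [hadd, add_mul, Finset.sum_add_distrib]
        map_smul' := fun a r => by
          simp only [hsmul, smul_mul_assoc, Finset.smul_sum, RingHom.id_apply] }
  have hcon : ∀ r ∈ LinearMap.ker con, ∀ c, X ^ D ∣ (P r).eval (p c) := fun r hr c => by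
    rw [X_pow_dvd_iff]
    intro i hi
    have := congrFun (congrFun (LinearMap.mem_ker.1 hr) c) ⟨i, hi⟩
    simpa [con, P, eval_finsetSum] using this
  have hev_inj : Function.Injective ev := by
    rw [← LinearMap.ker_eq_bot, LinearMap.ker_eq_bot']
    intro r hr
    have h0 := hmin _ (hPdeg r) ((hev r).symm.trans hr)
    funext j
    have := hPcoeff r j
    rw [h0, coeff_zero, eq_comm, mul_eq_zero] at this
    exact Subtype.ext (this.resolve_right (pow_ne_zero _ X_ne_zero))
  have hW : Module.finrank A W = (d + 1) * (N + 1) := by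
    rw [Module.finrank_pi_fintype]
    simp [(degreeLTEquiv A (N + 1)).finrank_eq]
  have hker : 2 ≤ Module.finrank A (LinearMap.ker con) := by
    have h1 := con.finrank_range_add_finrank_ker
    have h2 := Submodule.finrank_le (LinearMap.range con)
    rw [Module.finrank_pi_fintype] at h2
    simp only [Module.finrank_fin_fun, Finset.sum_const, Finset.card_univ, Fintype.card_coe,
      Finset.card_erase_of_mem hc₁, hcard, smul_eq_mul, add_tsub_cancel_right] at h2
    rw [hW] at h1
    nlinarith
  obtain ⟨r, hr, hrt⟩ : ∃ r ∈ LinearMap.ker con, ev r ∉ Submodule.span A {t ^ D} := by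
    by_contra! hall
    have h1 : (LinearMap.ker con).map ev ≤ Submodule.span A {t ^ D} := by
      rintro _ ⟨r, hr, rfl⟩
      exact hall r hr
    have h2 := Submodule.finrank_mono h1
    rw [finrank_span_singleton (pow_ne_zero _ ht),
      (Submodule.equivMapOfInjective ev hev_inj _).finrank_eq.symm] at h2
    omega
  refine ⟨ev r / t ^ D, ?_, ?_, c₁, hroot hc₁, fun O hO hh => ?_⟩
  · have htm : t ∈ IntermediateField.adjoin A {t, y} :=
      IntermediateField.subset_adjoin _ _ (Set.mem_insert _ _)
    have hym : y ∈ IntermediateField.adjoin A {t, y} :=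
      IntermediateField.subset_adjoin _ _ (Set.mem_insert_of_mem _ rfl)
    rw [hevdef]
    refine div_mem (sum_mem fun j _ => mul_mem ?_ (pow_mem hym _)) (pow_mem htm _)
    rw [aeval_eq_sum_range]
    exact sum_mem fun i _ => IntermediateField.smul_mem _ (pow_mem htm _)
  · rintro ⟨a, ha⟩
    refine hrt (Submodule.mem_span_singleton.2 ⟨a, ?_⟩)
    rw [Algebra.smul_def, ha, div_mul_cancel₀ _ (pow_ne_zero _ ht)]
  have htlt : O.valuation t < 1 := by
    by_contra! hge
    refine hh ?_
    have hy' : O.valuation y ≤ O.valuation t ^ e :=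
      O.valuation.le_of_eval₂_eq_zero hf hy (one_le_pow₀ hge) fun j =>
        ValuationSubring.valuation_aeval_le hO fun i hi => pow_le_pow_right₀ hge (hi.trans (he j))
    rw [← O.valuation_le_one_iff, map_div₀, map_pow,
      div_le_one₀ (pow_pos (zero_lt_one.trans_le hge) _)]
    rw [hevdef]
    refine O.valuation.map_sum_le fun j _ => ?_
    have h1 : O.valuation (aeval t (r j : A[X])) ≤ O.valuation t ^ N :=
      ValuationSubring.valuation_aeval_le hO fun i hi => by
        refine pow_le_pow_right₀ hge (hi.trans ?_)
        have := mem_degreeLT.1 (r j).2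
        exact natDegree_le_of_degree_le (degree_lt_iff_coeff_zero _ _ |>.1 this |> fun h =>
          (degree_le_iff_coeff_zero _ _).2 fun m hm => h m (by exact_mod_cast hm))
    calc _ = O.valuation (aeval t (r j : A[X])) * O.valuation t ^ (e * (d - j)) *
            O.valuation y ^ (j : ℕ) := by simp
      _ ≤ O.valuation t ^ N * O.valuation t ^ (e * (d - j)) * (O.valuation t ^ e) ^ (j : ℕ) := by
          gcongr
      _ = O.valuation t ^ D := by
          rw [← pow_mul, ← pow_add, ← pow_add, hD, add_assoc, ← mul_add,
            Nat.sub_add_cancel (Nat.lt_succ_iff.1 j.2)]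
  refine ⟨htlt, ?_⟩
  have htO : t ∈ O := ValuationSubring.mem_of_valuation_lt_one htlt
  have hφO : ∀ q, φ q ∈ O := fun q => by
    rw [← O.valuation_le_one_iff]
    exact ValuationSubring.valuation_aeval_le hO fun i _ => pow_le_one' htlt.le i
  have hyO : y ∈ O := by
    rw [← O.valuation_le_one_iff]
    exact O.valuation.le_of_eval₂_eq_zero hf hy le_rfl fun j =>
      (O.valuation_le_one_iff _).2 (hφO _)
  let g : A[X] →+* O := φ.codRestrict O.toSubring hφO
  have hgm : g X ∈ IsLocalRing.maximalIdeal O := by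
    rw [O.valuation_lt_one_iff]
    exact (congrArg O.valuation hφX).trans_lt htlt
  have hg2 : ∀ G : A[X][X], ((G.eval₂ g ⟨y, hyO⟩ : O) : F) = G.eval₂ φ y := fun G =>
    hom_eval₂ G g O.subtype ⟨y, hyO⟩
  have hgy : f.eval₂ g ⟨y, hyO⟩ = 0 := Subtype.ext ((hg2 f).trans hy)
  obtain ⟨c, hc, hyc⟩ := exists_root_sub_mem_maximalIdeal hgm hf (IsAlgClosed.splits _) hgy
  have hval : O.valuation (y - algebraMap A F c) < 1 := by
    rw [← hφC]
    exact (O.valuation_lt_one_iff _).1 hyc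
  by_cases hcc : c = c₁
  · rwa [← hcc]
  exfalso
  refine hh ?_
  have hc' := Finset.mem_erase.2 ⟨hcc, Multiset.mem_toFinset.2 hc⟩
  -- At another point `c` of the fibre, `y` agrees with `p c` modulo `t ^ D`, so the imposed
  -- vanishing makes `ev r` divisible by `t ^ D`.
  have h1 := pow_dvd_sub_map hgm hgy (hder (Multiset.mem_toFinset.2 hc)) hyc (hp0 ⟨c, hc'⟩)
    (hpD ⟨c, hc'⟩)
  have h2 : g X ^ D ∣ (P r).eval₂ g ⟨y, hyO⟩ := by
    have h3 := sub_dvd_eval_sub (⟨y, hyO⟩ : O) (g (p ⟨c, hc'⟩)) ((P r).map g)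
    rw [eval_map, eval_map, eval₂_at_apply] at h3
    rw [dvd_iff_dvd_of_dvd_sub (h1.trans h3), ← map_pow]
    exact map_dvd g (hcon r hr _)
  obtain ⟨b, hb⟩ := h2
  have h4 : ev r = t ^ D * b := by
    rw [hev, ← hg2, hb, ← hφX]
    rfl
  rw [h4, mul_div_cancel_left₀ _ (pow_ne_zero _ ht)]
  exact b.2

end Localizing

/-! ### Valuations determined by a simple point of a curve. -/

section Determination

open Polynomial

theorem ValuationSubring.valuation_eval₂_sub_le {A F : Type*} [Field A] [Field F] [Algebra A F]
    {O : ValuationSubring F} (hO : ∀ a : A, algebraMap A F a ∈ O) {t y : F}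
    (ht : O.valuation t < 1) {f : A[X][X]}
    (hy : f.eval₂ (aeval t : A[X] →ₐ[A] F).toRingHom y = 0) {c : A}
    (h1 : (f.map (evalRingHom 0)).derivative.eval c ≠ 0)
    (hyc : O.valuation (y - algebraMap A F c) < 1) {p : A[X]} (hp : p.eval 0 = c) {N : ℕ}
    (hdvd : X ^ N ∣ f.eval p) (G : A[X][X]) :
    O.valuation (G.eval₂ (aeval t : A[X] →ₐ[A] F).toRingHom y - aeval t (G.eval p)) ≤
      O.valuation t ^ N := by
  set φ : A[X] →+* F := (aeval t : A[X] →ₐ[A] F).toRingHom with hφ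
  have hφX : φ X = t := aeval_X t
  have hφC : φ (C c) = algebraMap A F c := aeval_C t c
  have hφO : ∀ q, φ q ∈ O := fun q => by
    rw [← O.valuation_le_one_iff]
    exact valuation_aeval_le hO fun i _ => pow_le_one' ht.le i
  have hyO : y ∈ O := by
    have := O.add_mem _ _ (mem_of_valuation_lt_one hyc) (hO c)
    rwa [sub_add_cancel] at this
  let g : A[X] →+* O := φ.codRestrict O.toSubring hφO
  have hgm : g X ∈ IsLocalRing.maximalIdeal O := by
    rw [O.valuation_lt_one_iff]
    exact (congrArg O.valuation hφX).trans_lt ht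
  have hg2 : ∀ G : A[X][X], ((G.eval₂ g ⟨y, hyO⟩ : O) : F) = G.eval₂ φ y := fun G =>
    hom_eval₂ G g O.subtype ⟨y, hyO⟩
  have h2 := pow_dvd_sub_map hgm (Subtype.ext ((hg2 f).trans hy)) h1
    ((O.valuation_lt_one_iff (⟨y, hyO⟩ - g (C c))).2 (by rw [← hφC] at hyc; exact hyc)) hp hdvd
  have h3 := sub_dvd_eval_sub (⟨y, hyO⟩ : O) (g p) (G.map g)
  rw [eval_map, eval_map, eval₂_at_apply] at h3
  obtain ⟨b, hb⟩ := h2.trans h3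
  have h4 : G.eval₂ φ y - aeval t (G.eval p) = t ^ N * b := by
    rw [← hg2]
    refine (congrArg Subtype.val hb).trans ?_
    exact congrArg (fun s : F => s ^ N * (b : F)) hφX
  rw [h4, map_mul, map_pow]
  exact mul_le_of_le_one_right' ((O.valuation_le_one_iff _).2 b.2)

variable {k F : Type*} [Field k] [Field F] [Algebra k F]

theorem IntermediateField.exists_eval₂_div_eval₂ {E : IntermediateField k F} {t y x : F}
    (hx : x ∈ adjoin E {t, y}) :
    ∃ G₁ G₂ : E[X][X], x = G₁.eval₂ (aeval t : E[X] →ₐ[E] F).toRingHom y /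
      G₂.eval₂ (aeval t : E[X] →ₐ[E] F).toRingHom y := by
  have key : ∀ z ∈ Algebra.adjoin E {t, y},
      ∃ G : E[X][X], z = G.eval₂ (aeval t : E[X] →ₐ[E] F).toRingHom y := fun z hz => by
    induction hz using Algebra.adjoin_induction with
    | mem z hz =>
      rcases hz with rfl | rfl
      · exact ⟨C X, by simp⟩
      · exact ⟨X, by simp⟩
    | algebraMap r => exact ⟨C (C r), by simp⟩
    | add _ _ _ _ h₁ h₂ =>
      obtain ⟨G₁, rfl⟩ := h₁
      obtain ⟨G₂, rfl⟩ := h₂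
      exact ⟨G₁ + G₂, (eval₂_add _ _).symm⟩
    | mul _ _ _ _ h₁ h₂ =>
      obtain ⟨G₁, rfl⟩ := h₁
      obtain ⟨G₂, rfl⟩ := h₂
      exact ⟨G₁ * G₂, (eval₂_mul _ _).symm⟩
  obtain ⟨r, hr, s, hs, rfl⟩ := mem_adjoin_iff_div.1 hx
  obtain ⟨G₁, rfl⟩ := key r hr
  obtain ⟨G₂, rfl⟩ := key s hs
  exact ⟨G₁, G₂, rfl⟩

variable [IsAlgClosed F]

/-- Replace `y` by a truncation `p(t)` of its expansion at the simple point. For a fine enough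
truncation the value is the order of `G(t, p(t))` at `t = 0`, an exponent independent of the
valuation ring. -/
theorem IsCoeffField.exists_valuation_eval₂_eq_pow {O O' : ValuationSubring F}
    {E : IntermediateField k F} (hE : IsCoeffField O E) (hE' : ∀ x ∈ E, x ∈ O') {t y : F}
    (ht0 : t ≠ 0) (ht : O.valuation t < 1) (ht' : O'.valuation t < 1) {f : E[X][X]}
    (hy : f.eval₂ (aeval t : E[X] →ₐ[E] F).toRingHom y = 0) {c : E}
    (h0 : (f.map (evalRingHom 0)).eval c = 0)
    (h1 : (f.map (evalRingHom 0)).derivative.eval c ≠ 0)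
    (hyc : O.valuation (y - c) < 1) (hyc' : O'.valuation (y - c) < 1) {G : E[X][X]}
    (hG : G.eval₂ (aeval t : E[X] →ₐ[E] F).toRingHom y ≠ 0) :
    ∃ n, O.valuation (G.eval₂ (aeval t : E[X] →ₐ[E] F).toRingHom y) = O.valuation t ^ n ∧
      O'.valuation (G.eval₂ (aeval t : E[X] →ₐ[E] F).toRingHom y) = O'.valuation t ^ n := by
  set z := G.eval₂ (aeval t : E[X] →ₐ[E] F).toRingHom y
  obtain ⟨N, hN⟩ := hE.exists_pow_mul_mem ht0 ht z⁻¹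
  have hvt : ∀ V : ValuationSubring F, 0 < V.valuation t := fun V => by
    rw [zero_lt_iff]; simpa using ht0
  have hz : O.valuation t ^ (N + 1) < O.valuation z := by
    rw [← O.valuation_le_one_iff, map_mul, map_pow, map_inv₀, ← div_eq_mul_inv,
      div_le_one₀ (by rw [zero_lt_iff]; simpa using hG)] at hN
    exact (pow_lt_pow_right_of_lt_one₀ (hvt O) ht N.lt_succ_self).trans_le hN
  -- `N` is chosen at `O` by the archimedean property. The resulting exponent is at most `N`, so
  -- precision `N + 1` also suffices at `O'`.
  obtain ⟨p, hp, hdvd⟩ := exists_pow_dvd_eval h0 h1 (N + 1)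
  have h2 := ValuationSubring.valuation_eval₂_sub_le (fun a : E => hE.mem_of_mem a a.2) ht hy h1 hyc hp
    hdvd G
  have h2' := ValuationSubring.valuation_eval₂_sub_le (fun a : E => hE' a a.2) ht' hy h1 hyc' hp
    hdvd G
  set w := aeval t (G.eval p)
  have h3 : O.valuation w = O.valuation z := by
    rw [← sub_add_cancel w z]
    refine Valuation.map_add_eq_of_lt_right _ ?_
    rw [Valuation.map_sub_swap]
    exact h2.trans_lt hz
  have hw : G.eval p ≠ 0 := fun h => by
    rw [show w = 0 by simp [w, h], map_zero] at h3
    exact (zero_le.trans_lt hz).ne h3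
  have h4 := ValuationSubring.valuation_aeval hE.mem_of_mem ht hw
  have h4' := ValuationSubring.valuation_aeval hE' ht' hw
  refine ⟨_, h3.symm.trans h4, ?_⟩
  have hlt : (G.eval p).rootMultiplicity 0 < N + 1 := by
    rw [← h3, h4] at hz
    exact (pow_lt_pow_iff_right_of_lt_one₀ (hvt O) ht).1 hz
  rw [← h4', ← sub_add_cancel z w]
  refine Valuation.map_add_eq_of_lt_right _ (h2'.trans_lt ?_)
  rw [h4']
  exact pow_lt_pow_right_of_lt_one₀ (hvt O') ht' hlt

theorem IsCoeffField.mem_of_mem_adjoin_pair {O O' : ValuationSubring F}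
    {E : IntermediateField k F} (hE : IsCoeffField O E) (hE' : ∀ x ∈ E, x ∈ O') {t y : F}
    (ht0 : t ≠ 0) (ht : O.valuation t < 1) (ht' : O'.valuation t < 1) {f : E[X][X]}
    (hy : f.eval₂ (aeval t : E[X] →ₐ[E] F).toRingHom y = 0) {c : E}
    (h0 : (f.map (evalRingHom 0)).eval c = 0)
    (h1 : (f.map (evalRingHom 0)).derivative.eval c ≠ 0)
    (hyc : O.valuation (y - c) < 1) (hyc' : O'.valuation (y - c) < 1) {x : F}
    (hx : x ∈ IntermediateField.adjoin E {t, y}) (hxO : x ∈ O) : x ∈ O' := by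
  obtain ⟨G₁, G₂, rfl⟩ := IntermediateField.exists_eval₂_div_eval₂ hx
  by_cases hG₁ : G₁.eval₂ (aeval t : E[X] →ₐ[E] F).toRingHom y = 0
  · rw [hG₁, zero_div]; exact O'.zero_mem
  by_cases hG₂ : G₂.eval₂ (aeval t : E[X] →ₐ[E] F).toRingHom y = 0
  · rw [hG₂, div_zero]; exact O'.zero_mem
  obtain ⟨m, hm, hm'⟩ := hE.exists_valuation_eval₂_eq_pow hE' ht0 ht ht' hy h0 h1 hyc hyc' hG₁
  obtain ⟨n, hn, hn'⟩ := hE.exists_valuation_eval₂_eq_pow hE' ht0 ht ht' hy h0 h1 hyc hyc' hG₂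
  have hvt : ∀ V : ValuationSubring F, 0 < V.valuation t := fun V => by
    rw [zero_lt_iff]; simpa using ht0
  rw [← ValuationSubring.valuation_le_one_iff, map_div₀, hm, hn, div_le_one₀ (pow_pos (hvt O) _),
    pow_le_pow_iff_right_of_lt_one₀ (hvt O) ht] at hxO
  rwa [← ValuationSubring.valuation_le_one_iff, map_div₀, hm', hn',
    div_le_one₀ (pow_pos (hvt O') _), pow_le_pow_iff_right_of_lt_one₀ (hvt O') ht']

end Determination

/-! ### Plane models with an unramified fibre. -/

section Generators

open Polynomial

/-- Take `ρ` to be the resultant of `f` and its derivative. It is nonzero because, by Gauss's lemma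
and characteristic zero, `f` is separable over the fraction field. -/
theorem Polynomial.exists_isCoprime_map_of_irreducible {R : Type*} [CommRing R] [IsDomain R]
    [IsIntegrallyClosed R] [CharZero R] {f : R[X]} (hf : f.Monic) (hirr : Irreducible f) :
    ∃ ρ ≠ 0, ∃ p q, f * p + derivative f * q = C ρ := by
  have hd : f.natDegree ≠ 0 := hf.natDegree_pos_of_not_isUnit hirr.not_isUnit |>.ne'
  obtain ⟨p, q, -, -, h⟩ := exists_mul_add_mul_eq_C_resultant f (derivative f) le_rfl le_rfl
    (Or.inl hd)
  refine ⟨_, fun h0 => ?_, p, q, h⟩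
  have hinj := IsFractionRing.injective R (FractionRing R)
  have : CharZero (FractionRing R) := charZero_of_injective_algebraMap hinj
  have hsep := ((hf.irreducible_iff_irreducible_map_fraction_map (K := FractionRing R)).1
    hirr).separable
  rw [separable_def, derivative_map] at hsep
  refine resultant_ne_zero _ _ hsep ?_
  rw [natDegree_map_eq_of_injective hinj, natDegree_map_eq_of_injective hinj, resultant_map_map,
    h0, map_zero]

theorem IsAlgebraic.of_adjoin_singleton {A F : Type*} [Field A] [Field F] [Algebra A F] {s y : F}
    [Algebra A[X] F] (hs : algebraMap A[X] F = (aeval s : A[X] →ₐ[A] F).toRingHom)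
    (hy : IsAlgebraic (IntermediateField.adjoin A {s}) y) : IsAlgebraic A[X] y := by
  rw [IntermediateField.isAlgebraic_adjoin_iff] at hy
  have h1 : ∀ p : A[X], aeval s p ∈ Algebra.adjoin A {s} :=
    fun _ => aeval_mem_adjoin_singleton A s
  refine IsAlgebraic.of_ringHom_of_comp_eq (S := Algebra.adjoin A {s}) (B := F)
    ((aeval s : A[X] →ₐ[A] F).codRestrict (Algebra.adjoin A {s}) h1) (RingHom.id F) hy ?_
    Function.injective_id ?_
  · rintro ⟨x, hx⟩
    rw [Algebra.adjoin_singleton_eq_range_aeval] at hx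
    obtain ⟨p, hp⟩ := hx
    exact ⟨p, Subtype.ext hp⟩
  · rw [hs]
    rfl

/-- Clear denominators to make `y₀` integral over `A[s]`, and translate `s` to a point `a` where `ρ`
does not vanish. The translate of the minimal polynomial is then separable at zero. -/
theorem exists_monic_separable_of_transcendental {A F : Type*} [Field A] [CharZero A] [Field F]
    [Algebra A F] {s : F} (hs : Transcendental A s) {y₀ : F}
    (hy₀ : IsAlgebraic (IntermediateField.adjoin A {s}) y₀) :
    ∃ (a : A) (r : A[X]) (f : A[X][X]), r ≠ 0 ∧ f.Monic ∧
      f.eval₂ (aeval (s - algebraMap A F a) : A[X] →ₐ[A] F).toRingHom (aeval s r * y₀) = 0 ∧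
      (∀ g : A[X][X], g.degree < f.degree →
        g.eval₂ (aeval (s - algebraMap A F a) : A[X] →ₐ[A] F).toRingHom (aeval s r * y₀) = 0 →
          g = 0) ∧
      (f.map (evalRingHom 0)).Separable := by
  let : Algebra A[X] F := (aeval s : A[X] →ₐ[A] F).toRingHom.toAlgebra
  have hinj : Function.Injective (algebraMap A[X] F) := transcendental_iff_injective.1 hs
  have : FaithfulSMul A[X] F := (faithfulSMul_iff_algebraMap_injective _ _).2 hinj
  obtain ⟨r, hr, hint⟩ := (hy₀.of_adjoin_singleton rfl).exists_integral_multiple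
  rw [Algebra.smul_def] at hint
  set y := algebraMap A[X] F r * y₀
  set f := minpoly A[X] y
  obtain ⟨ρ, hρ, p, q, hpq⟩ := exists_isCoprime_map_of_irreducible (minpoly.monic hint)
    (minpoly.irreducible hint)
  obtain ⟨a, ha⟩ : ∃ a, ρ.eval a ≠ 0 := by
    by_contra! h
    exact hρ (Polynomial.funext fun x => by rw [h, eval_zero])
  let e : A[X] ≃ₐ[A] A[X] := algEquivAevalXAddC a
  let e' : A[X] →+* A[X] := e
  let i' : A[X] →+* A[X] := e.symm
  have he : Function.Injective e' := e.injective
  have hi : Function.Injective i' := e.symm.injective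
  have heX : e' X = X + C a := aeval_X _
  have heC : ∀ b, e' (C b) = C b := fun b => aeval_C _ b
  have hei : e'.comp i' = RingHom.id _ := RingHom.ext fun p => e.apply_symm_apply p
  set φ : A[X] →+* F := (aeval (s - algebraMap A F a) : A[X] →ₐ[A] F).toRingHom
  have hφX : φ X = s - algebraMap A F a := aeval_X _
  have hφC : ∀ b, φ (C b) = algebraMap A F b := fun b => aeval_C _ b
  have hφ : φ.comp e' = algebraMap A[X] F := by
    refine Polynomial.ringHom_ext (fun b => ?_) ?_
    · rw [RingHom.comp_apply, heC, hφC]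
      exact (aeval_C s b).symm
    · rw [RingHom.comp_apply, heX, map_add, hφX, hφC, sub_add_cancel]
      exact (aeval_X s).symm
  have hev : (evalRingHom 0).comp e' = evalRingHom a := by
    refine Polynomial.ringHom_ext (fun b => ?_) ?_
    · rw [RingHom.comp_apply, heC]; simp
    · rw [RingHom.comp_apply, heX]; simp
  refine ⟨a, r, f.map e', hr, (minpoly.monic hint).map _, ?_, fun g hg hg0 => ?_, ?_⟩
  · rw [eval₂_map, hφ]
    exact minpoly.aeval _ y
  · by_contra hne
    have h1 : (g.map i').map e' = g := by rw [map_map, hei, map_id]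
    have h2 := minpoly.IsIntegrallyClosed.degree_le_of_ne_zero (R := A[X]) (s := y)
      ((Polynomial.map_ne_zero_iff hi).2 hne) (by
        rw [← h1, eval₂_map, hφ] at hg0
        exact hg0)
    rw [degree_map_eq_of_injective hi] at h2
    rw [degree_map_eq_of_injective he] at hg
    exact h2.not_gt hg
  · rw [map_map, hev, separable_def, derivative_map]
    have h1 := congrArg (mapRingHom (evalRingHom a)) hpq
    simp only [map_add, map_mul, coe_mapRingHom, map_C, coe_evalRingHom] at h1
    refine ⟨C (ρ.eval a)⁻¹ * p.map (evalRingHom a), C (ρ.eval a)⁻¹ * q.map (evalRingHom a), ?_⟩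
    have h2 : (C (ρ.eval a)⁻¹ * C (ρ.eval a) : A[X]) = 1 := by
      rw [← C_mul, inv_mul_cancel₀ ha, C_1]
    linear_combination C (ρ.eval a)⁻¹ * h1 + h2

end Generators

/-! ### A pole that determines the valuation on a finite set. -/

section Determination

open Polynomial

variable {k F : Type*} [Field k] [CharZero k] [Field F] [Algebra k F]

theorem exists_subset_adjoin_simple {K : IntermediateField k F} {S : Finset F}
    (hS : ∀ x ∈ S, IsAlgebraic K x) : ∃ y : F, IsAlgebraic K y ∧
    (S : Set F) ⊆ IntermediateField.adjoin K {y} := by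
  have : FiniteDimensional K (IntermediateField.adjoin K (S : Set F)) :=
    IntermediateField.finiteDimensional_adjoin fun x hx => (hS x hx).isIntegral
  have : CharZero K := charZero_of_injective_algebraMap (algebraMap k K).injective
  obtain ⟨y, hy⟩ := Field.exists_primitive_element K (IntermediateField.adjoin K (S : Set F))
  refine ⟨y, ?_, ?_⟩
  · exact (Algebra.IsAlgebraic.isAlgebraic (R := K) y).algHom
      (IntermediateField.adjoin K (S : Set F)).val
  · have h1 := congrArg IntermediateField.lift hy
    rw [IntermediateField.lift_adjoin_simple, IntermediateField.lift_top] at h1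
    rw [h1]
    exact IntermediateField.subset_adjoin _ _

/-- A primitive element gives a plane model over `A` whose function field contains `S`. The function
from `exists_notMem_range_forall_valuation_lt_one` has its pole at a single simple point, which
persists after extending constants from `A` to `E`. -/
theorem exists_determinesValuation [IsAlgClosed F] {A : IntermediateField k F}
    (hA : IsRelClosed A) {s : F} (hs : s ∉ A) (S : Finset F)
    (hS : (S : Set F) ⊆ acl k (insert s (A : Set F))) :
    ∃ h ∈ acl k (insert s (A : Set F)), h ∉ A ∧ DeterminesValuation A h (S : Set F) := by
  have : IsAlgClosed A := isAlgClosed_of_isRelClosed hA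
  have : CharZero A := charZero_of_injective_algebraMap (algebraMap k A).injective
  obtain ⟨y₀, hy₀, hSy⟩ := exists_subset_adjoin_simple (K := IntermediateField.adjoin A {s})
    fun x hx => mem_acl.1 (mem_acl_insert_iff.1 (hS hx))
  obtain ⟨a, r, f, hr, hf, hy, hmin, hsep⟩ :=
    exists_monic_separable_of_transcendental (hA.notMem_iff_transcendental.1 hs) hy₀
  set t := s - algebraMap A F a
  set y := aeval s r * y₀
  have ht0 : t ≠ 0 := sub_ne_zero.2 fun h => hs (h ▸ a.2)
  obtain ⟨h, hh, hhA, c, hc, hO⟩ := exists_notMem_range_forall_valuation_lt_one ht0 hf hy hmin hsep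
  have hincl : ∀ E : IntermediateField k F, A ≤ E → ∀ T : Set F,
      (IntermediateField.adjoin A T : Set F) ⊆ IntermediateField.adjoin E T := fun E hAE T => by
    have : (IntermediateField.adjoin A T).restrictScalars k ≤
        (IntermediateField.adjoin E T).restrictScalars k := by
      rw [IntermediateField.restrictScalars_adjoin, IntermediateField.restrictScalars_adjoin]
      exact IntermediateField.adjoin.mono _ _ _ (Set.union_subset_union_left _ hAE)
    exact this
  refine ⟨h, ?_, fun hA' => hhA ⟨⟨h, hA'⟩, rfl⟩, fun O O' E hAE hE hE' hhO hhO' x hx hxO => ?_⟩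
  · have hAB : (A : Set F) ⊆ acl k (insert s (A : Set F)) :=
      (Set.subset_insert _ _).trans (subset_acl _)
    have hsB : s ∈ acl k (insert s (A : Set F)) := subset_acl _ (Set.mem_insert _ _)
    have hy₀B : y₀ ∈ acl k (insert s (A : Set F)) := mem_acl_insert_iff.2 (mem_acl.2 hy₀)
    have : (IntermediateField.adjoin A {t, y}).restrictScalars k ≤
        acl k (insert s (A : Set F)) := by
      rw [IntermediateField.restrictScalars_adjoin, IntermediateField.adjoin_le_iff]
      refine Set.union_subset hAB (Set.insert_subset (sub_mem hsB (hAB a.2))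
        (Set.singleton_subset_iff.2 (mul_mem ?_ hy₀B)))
      rw [aeval_eq_sum_range]
      exact sum_mem fun i _ => mul_mem (hAB (r.coeff i).2) (pow_mem hsB i)
    exact this hh
  have hder : (f.map (evalRingHom 0)).derivative.eval c ≠ 0 :=
    hsep.aeval_derivative_ne_zero (x := c) hc
  let ι : A →+* E := IntermediateField.inclusion hAE
  have hev : (evalRingHom 0).comp (mapRingHom ι) = ι.comp (evalRingHom 0) := by
    refine Polynomial.ringHom_ext (fun b => by simp) (by simp)
  have hφ : (aeval t : E[X] →ₐ[E] F).toRingHom.comp (mapRingHom ι) =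
      (aeval t : A[X] →ₐ[A] F).toRingHom := by
    refine Polynomial.ringHom_ext (fun b => ?_) (by simp)
    simp
    rfl
  have h1 := hO O (fun b => hE.mem_of_mem b (hAE b.2)) hhO
  have h2 := hO O' (fun b => hE'.mem_of_mem b (hAE b.2)) hhO'
  refine hE.mem_of_mem_adjoin_pair hE'.mem_of_mem ht0 h1.1 h2.1 (f := f.map (mapRingHom ι))
    (c := ι c) ?_ ?_ ?_ h1.2 h2.2 ?_ hxO
  · rw [eval₂_map, hφ, hy]
  · rw [map_map, hev, ← map_map, eval_map, eval₂_at_apply, hc, map_zero]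
  · rw [map_map, hev, ← map_map, derivative_map, eval_map, eval₂_at_apply]
    exact (map_ne_zero ι).2 hder
  · set M := IntermediateField.adjoin E {t, y}
    have hS' : (S : Set F) ⊆ IntermediateField.adjoin A {t, y} := by
      have hsM : s ∈ IntermediateField.adjoin A {t, y} := by
        rw [← sub_add_cancel s (algebraMap A F a)]
        exact add_mem (IntermediateField.mem_adjoin_pair_left _ _ _)
          (IntermediateField.algebraMap_mem _ a)
      have hrM : aeval s r ∈ IntermediateField.adjoin A {t, y} := by
        rw [aeval_eq_sum_range]
        exact sum_mem fun i _ => IntermediateField.smul_mem _ (pow_mem hsM _)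
      have hr0 : aeval s r ≠ 0 := fun h0 =>
        hr (transcendental_iff.1 (hA.notMem_iff_transcendental.1 hs) r h0)
      have : (IntermediateField.adjoin (IntermediateField.adjoin A {s}) {y₀}).restrictScalars A ≤
          IntermediateField.adjoin A {t, y} := by
        rw [IntermediateField.adjoin_adjoin_left, IntermediateField.adjoin_le_iff]
        refine Set.union_subset (Set.singleton_subset_iff.2 hsM) (Set.singleton_subset_iff.2 ?_)
        rw [← mul_div_cancel_left₀ y₀ hr0]
        exact div_mem (IntermediateField.mem_adjoin_pair_right _ _ _) hrM
      exact hSy.trans this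
    have : IntermediateField.adjoin k (insert h ((E : Set F) ∪ S)) ≤ M.restrictScalars k := by
      rw [IntermediateField.adjoin_le_iff]
      exact Set.insert_subset (hincl E hAE _ hh) (Set.union_subset
        (fun e he => M.algebraMap_mem ⟨e, he⟩) (hS'.trans (hincl E hAE _)))
    exact this hx

end Determination

/-! ### Density of the group generated by two decomposition groups. -/

section Density

open ValuationSubring Pointwise

variable {k F : Type*} [Field k] [Field F] [Algebra k F]

namespace IsCoeffField

variable {O O' : ValuationSubring F} {E E' : IntermediateField k F}

theorem exists_mem_notMem (hE : IsCoeffField O E) {A : IntermediateField k F} (hAE : A ≤ E)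
    {b h : F} (hb : b ∉ A) (hh : h ∉ acl k (insert b (A : Set F))) :
    ∃ e ∈ E, e ∉ A := by
  by_contra! hcon
  obtain rfl : A = E := le_antisymm hAE hcon
  exact hh (hE.mem_acl_insert hb h)

theorem valuation_sub_eq_one (hE : IsCoeffField O E) {e z a : F} (he : e ∈ E) (ha : a ∈ E)
    (hne : e ≠ a) (hz : O.valuation (z - e) < 1) : O.valuation (z - a) = 1 := by
  have h1 := valuation_eq_one_of_mem_field hE.mem_of_mem (sub_mem he ha) (sub_ne_zero.2 hne)
  rw [← sub_add_sub_cancel z e a, Valuation.map_add_eq_of_lt_right _ (by rwa [h1]), h1]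

theorem notMem_of_congr (hE : IsCoeffField O E) {A : IntermediateField k F} (hAE : A ≤ E)
    {e z : F} (he : e ∈ E) (heA : e ∉ A) (hz : O.valuation (z - e) < 1) : z ∉ A := fun hzA => by
  have := hE.valuation_sub_eq_one he (hAE hzA) (fun h => heA (h ▸ hzA)) hz
  rw [sub_self, map_zero] at this
  exact zero_ne_one this

theorem exists_finset_subset_acl_insert (hE : IsCoeffField O E) (S : Finset F) :
    ∃ (S₀ : Finset F) (s : F), s ∉ acl k (S₀ : Set F) ∧
      (S : Set F) ⊆ acl k (insert s (S₀ : Set F)) := by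
  classical
  induction S using Finset.induction_on with
  | empty =>
    obtain ⟨h, hh, -⟩ := hE.exists_spanning
    exact ⟨∅, h, fun h' => hh (hE.mem_of_mem _ (acl_le hE.isRelClosed (by simp) h')), by simp⟩
  | insert b S _ ih =>
    obtain ⟨S₀, s, hs, hS⟩ := ih
    rw [Finset.coe_insert]
    by_cases hb : b ∈ acl k (insert s (S₀ : Set F))
    · exact ⟨S₀, s, hs, Set.insert_subset hb hS⟩
    · refine ⟨insert s S₀, b, by rwa [Finset.coe_insert], ?_⟩
      rw [Finset.coe_insert]
      exact Set.insert_subset (subset_acl _ (Set.mem_insert _ _))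
        (hS.trans (acl_mono (Set.subset_insert _ _)))

variable [IsAlgClosed F] [CharZero k]

/-- The group generated by two decomposition groups moves finitely generated subfields into both
valuation rings. -/
theorem exists_apply_mem (hE : IsCoeffField O E) (hE' : IsCoeffField O' E') (hne : O ≠ O')
    (S : Finset F) (hS : ∃ h, h ∉ acl k (S : Set F)) :
    ∃ g ∈ O.decompositionSubgroup k ⊔ O'.decompositionSubgroup k,
      ∀ x ∈ acl k (S : Set F), g x ∈ O ∧ g x ∈ O' := by
  classical
  induction S using Finset.induction_on with
  | empty =>
    refine ⟨1, one_mem _, fun x hx => ⟨hE.mem_of_mem _ ?_, hE'.mem_of_mem _ ?_⟩⟩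
    · exact acl_le hE.isRelClosed (by simp) hx
    · exact acl_le hE'.isRelClosed (by simp) hx
  | insert b S _ ih =>
    obtain ⟨h, hh⟩ := hS
    rw [Finset.coe_insert] at hh ⊢
    obtain ⟨g, hgH, hg⟩ := ih ⟨h, fun h' => hh (acl_mono (Set.subset_insert _ _) h')⟩
    set S' := S.image g with hS'
    have hSS' : (S' : Set F) = g '' (S : Set F) := Finset.coe_image
    set A := acl k (S' : Set F) with hA
    have hAc : IsRelClosed A := isRelClosed_acl _
    have hAO : ∀ x ∈ A, x ∈ O ∧ x ∈ O' := fun x hx => by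
      rw [hA, hSS', ← SetLike.mem_coe, ← image_acl] at hx
      obtain ⟨y, hy, rfl⟩ := hx
      exact hg y hy
    have himg : g '' (insert b (S : Set F)) = insert (g b) (S' : Set F) := by
      rw [Set.image_insert_eq, hSS']
    have hh' : g h ∉ acl k (insert (g b) (A : Set F)) := by
      rw [hA, acl_insert_acl, ← himg]
      exact image_notMem g hh
    by_cases hbA : g b ∈ A
    · refine ⟨g, hgH, fun x hx => hAO _ ?_⟩
      have := map_mem_acl_image g hx
      rw [himg] at this
      exact acl_le hAc (Set.insert_subset hbA (subset_acl _)) this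
    obtain ⟨E₁, hE₁, hle⟩ := hE.exists_le S' fun x hx => (hAO x hx).1
    obtain ⟨E₁', hE₁', hle'⟩ := hE'.exists_le S' fun x hx => (hAO x hx).2
    obtain ⟨e, he, heA⟩ := hE₁.exists_mem_notMem hle hbA hh'
    obtain ⟨e', he', heA'⟩ := hE₁'.exists_mem_notMem hle' hbA hh'
    -- Move `g b` to `z` inside the first group, then `z` to `w` inside the second. Now `w` is
    -- congruent to `e` at `O` and to `e'` at `O'`, so its residue is transcendental over `A` on
    -- both sides.
    obtain ⟨z, hz, hz'⟩ := hE.exists_approx hE' hne (g b) e'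
    obtain ⟨w, hw, hw'⟩ := hE.exists_approx hE' hne e z
    have hzA : z ∉ A := hE₁'.notMem_of_congr hle' he' heA' hz'
    have hwA : w ∉ A := hE₁.notMem_of_congr hle he heA hw
    have hwe' : O'.valuation (w - e') < 1 := by
      rw [← sub_add_sub_cancel w z e']; exact Valuation.map_add_lt _ hw' hz'
    obtain ⟨g₁, hg₁, hg₁A, hg₁b⟩ := hE.exists_apply_eq_of_congr S' (fun x hx => (hAO x hx).1)
      hbA hzA hz
    obtain ⟨g₂, hg₂, hg₂A, hg₂b⟩ := hE'.exists_apply_eq_of_congr S' (fun x hx => (hAO x hx).2)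
      hzA hwA hw'
    refine ⟨g₂ * g₁ * g, mul_mem (mul_mem ((le_sup_right : _ ≤ O.decompositionSubgroup k ⊔ _) hg₂)
      ((le_sup_left : _ ≤ _ ⊔ O'.decompositionSubgroup k) hg₁)) hgH, fun x hx => ?_⟩
    have hx' : (g₂ * g₁ * g) x ∈ acl k (insert w (A : Set F)) := by
      have := map_mem_acl_image (g₂ * g₁ * g) hx
      refine acl_mono ?_ this
      rw [Set.image_insert_eq]
      refine Set.insert_subset ?_ ?_
      · rw [AlgEquiv.mul_apply, AlgEquiv.mul_apply, hg₁b, hg₂b]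
        exact Set.mem_insert _ _
      · rintro _ ⟨y, hy, rfl⟩
        have hyA : g y ∈ A := subset_acl _ (hSS' ▸ ⟨y, hy, rfl⟩)
        rw [AlgEquiv.mul_apply, AlgEquiv.mul_apply, hg₁A _ hyA, hg₂A _ hyA]
        exact Set.mem_insert_of_mem _ hyA
    constructor
    · exact acl_insert_subset hAc (fun y hy => (hAO y hy).1) (fun a ha =>
        hE₁.valuation_sub_eq_one he (hle ha) (fun h => heA (h ▸ ha)) hw) hx'
    · exact acl_insert_subset hAc (fun y hy => (hAO y hy).2) (fun a ha =>
        hE₁'.valuation_sub_eq_one he' (hle' ha) (fun h => heA' (h ▸ ha)) hwe') hx'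

/-- Once `acl k S` lies in both rings, approximate the image of `h` at `O` and a pole `p` at `O'` by
one `z`. Congruence at `O` moves that image to `z` over `A`. -/
theorem exists_apply_notMem (hE : IsCoeffField O E) (hE' : IsCoeffField O' E') (hne : O ≠ O')
    (S : Finset F) {h : F} (hh : h ∉ acl k (S : Set F)) :
    ∃ g ∈ O.decompositionSubgroup k ⊔ O'.decompositionSubgroup k,
      (∀ x ∈ acl k (S : Set F), g x ∈ O') ∧ g h ∉ O' := by
  classical
  obtain ⟨g, hgH, hg⟩ := hE.exists_apply_mem hE' hne S ⟨h, hh⟩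
  set S' := S.image g with hS'
  have hSS' : (S' : Set F) = g '' (S : Set F) := Finset.coe_image
  have hAO : ∀ x ∈ acl k (S' : Set F), x ∈ O ∧ x ∈ O' := fun x hx => by
    rw [hSS', ← SetLike.mem_coe, ← image_acl] at hx
    obtain ⟨y, hy, rfl⟩ := hx
    exact hg y hy
  have hgh : g h ∉ acl k (S' : Set F) := by rw [hSS']; exact image_notMem g hh
  obtain ⟨p, hp, -⟩ := hE'.exists_spanning
  obtain ⟨z, hz, hz'⟩ := hE.exists_approx hE' hne (g h) p
  have hzO : z ∉ O' := fun h => hp (by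
    simpa using O'.toSubring.sub_mem h (mem_of_valuation_lt_one hz'))
  obtain ⟨g₁, hg₁, hg₁A, hg₁h⟩ := hE.exists_apply_eq_of_congr S' (fun x hx => (hAO x hx).1)
    hgh (fun h => hzO (hAO z h).2) hz
  refine ⟨g₁ * g, mul_mem ((le_sup_left : _ ≤ _ ⊔ O'.decompositionSubgroup k) hg₁) hgH,
    fun x hx => ?_, ?_⟩
  · rw [AlgEquiv.mul_apply, hg₁A _ (by rw [hSS']; exact map_mem_acl_image g hx)]
    exact (hg x hx).2
  · rwa [AlgEquiv.mul_apply, hg₁h]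

theorem exists_mem_sup_apply_eq (hE : IsCoeffField O E) (hE' : IsCoeffField O' E') (hne : O ≠ O')
    (σ : F ≃ₐ[k] F) (S : Finset F) :
    ∃ g ∈ O.decompositionSubgroup k ⊔ O'.decompositionSubgroup k, ∀ x ∈ S, g x = σ x := by
  classical
  obtain ⟨S₀, s, hs, hS⟩ := hE.exists_finset_subset_acl_insert S
  set A := acl k (S₀ : Set F) with hA
  have hAc : IsRelClosed A := isRelClosed_acl _
  rw [← acl_insert_acl] at hS
  obtain ⟨h, hhs, hhA, hdet⟩ := exists_determinesValuation hAc hs S hS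
  have hSh : (S : Set F) ⊆ acl k (insert h (A : Set F)) := by
    refine hS.trans (acl_le_acl (Set.insert_subset ?_ ?_))
    · exact acl_exchange hhs (by rwa [hAc.acl_eq])
    · exact (Set.subset_insert _ _).trans (subset_acl _)
  obtain ⟨g₁, hg₁, hg₁A, hg₁h⟩ := hE.exists_apply_notMem hE' hne S₀ hhA
  have himg : ((S₀.image σ : Finset F) : Set F) = σ '' (S₀ : Set F) := Finset.coe_image
  obtain ⟨g₂, hg₂, hg₂A, hg₂h⟩ := hE.exists_apply_notMem hE' hne (S₀.image σ) (h := σ h)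
    (by rw [himg]; exact image_notMem σ hhA)
  have hmem : ∀ (g : F ≃ₐ[k] F) (x : F), x ∈ g⁻¹ • O' ↔ g x ∈ O' := fun g x => mem_smul_iff
  obtain ⟨E₁, hE₁, hle₁⟩ := (hE'.smul g₁⁻¹).exists_le S₀ fun x hx => (hmem _ _).2 (hg₁A x hx)
  obtain ⟨E₂, hE₂, hle₂⟩ := (hE'.smul g₂⁻¹).exists_le (S₀.image σ)
    fun x hx => (hmem _ _).2 (hg₂A x hx)
  obtain ⟨g, -, -, hgS, hgO⟩ := exists_algEquiv_smul_eq_of_apply hE₁ hE₂ hle₁ σ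
    (fun x hx => hle₂ (by rw [himg]; exact map_mem_acl_image σ hx))
    (fun h' => hg₁h ((hmem _ _).1 h')) (fun h' => hg₂h ((hmem _ _).1 h')) hSh hdet
  refine ⟨g, ?_, hgS⟩
  -- `g` carries `g₁⁻¹ O'` to `g₂⁻¹ O'`, so this product stabilizes `O'`, and `g` lies in the
  -- generated group.
  have hg : g₂ * g * g₁⁻¹ ∈ O'.decompositionSubgroup k := by
    rw [MulAction.mem_stabilizer_iff, mul_smul, mul_smul, hgO, smul_inv_smul]
  have := mul_mem (mul_mem (inv_mem hg₂)
    ((le_sup_right : _ ≤ O.decompositionSubgroup k ⊔ _) hg)) hg₁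
  rwa [← mul_assoc, ← mul_assoc, inv_mul_cancel, one_mul, inv_mul_cancel_right] at this

end IsCoeffField

end Density

/-! ### Coefficient fields of discrete valuation rings. -/

section DiscreteValuationRings

variable {k F : Type*} [Field k] [Field F] [Algebra k F]

-- The residues of `X` are algebraically independent, so nonzero polynomials in `X` are units and
-- `acl k X ⊆ O`. One of `t` and `t⁻¹` is a pole, because the class of `t` is nonzero.
open ValuationSubring in
theorem exists_isCoeffField_of_mem_discreteValuationRings {O : ValuationSubring F}
    (hO : O ∈ discreteValuationRings k F 1) : ∃ E : IntermediateField k F, IsCoeffField O E := by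
  obtain ⟨-, hk, hd⟩ := hO
  let := residueFieldAlgebra k O hk
  obtain ⟨X, t, hX, ht, halg⟩ := hd
  let c : k →+* O := (algebraMap k F).codRestrict O.toSubring hk
  let i : X → F := fun x => ((x : O) : F)
  have hval : ∀ p : MvPolynomial X k,
      ((p.eval₂ c (fun x : X => (x : O)) : O) : F) = MvPolynomial.aeval i p := fun p =>
    MvPolynomial.eval₂_comp_left O.subtype c (fun x : X => (x : O)) p
  have hres : ∀ p : MvPolynomial X k, IsLocalRing.residue O (p.eval₂ c (fun x : X => (x : O))) =
      MvPolynomial.aeval (fun x : X => IsLocalRing.residue O (x : O)) p := fun p =>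
    MvPolynomial.eval₂_comp_left (IsLocalRing.residue O) c (fun x : X => (x : O)) p
  have hone : ∀ p : MvPolynomial X k, p ≠ 0 → O.valuation (MvPolynomial.aeval i p) = 1 :=
    fun p hp => by
      rw [← hval, ← O.valuation_eq_one_iff, ← IsLocalRing.residue_ne_zero_iff_isUnit, hres]
      exact fun h => hp (hX.1 (h.trans (map_zero _).symm))
  have hadj : ∀ x ∈ IntermediateField.adjoin k (Set.range i), x ∈ O := fun x hx => by
    obtain ⟨p, q, rfl⟩ := (IntermediateField.mem_adjoin_range_iff k i x).1 hx
    by_cases hq : q = 0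
    · rw [hq, map_zero, div_zero]; exact O.zero_mem
    rw [← O.valuation_le_one_iff, map_div₀, hone q hq, div_one, ← hval, O.valuation_le_one_iff]
    exact Subtype.prop _
  have ht0 : (t 0 : F) ∉ O ∨ ((t 0)⁻¹ : F) ∉ O := by
    by_contra! hcon
    refine ht.ne_zero 0 ?_
    have : t 0 ∈ O.unitGroup := by
      rw [O.mem_unitGroup_iff]
      exact valuation_eq_one_of_mem (t 0).ne_zero hcon.1 hcon.2
    exact congrArg Additive.ofMul ((QuotientGroup.eq_one_iff _).2 this)
  have hspan : ∀ h : F, (h = t 0 ∨ h⁻¹ = t 0) → ∀ x,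
      x ∈ acl k (insert h (acl k (Set.range i) : Set F)) := fun h hh x => by
    have hx : x ∈ acl k (Set.range i ∪ Set.range fun j => (t j : F)) := mem_acl.2 (halg.1 x)
    rw [acl_insert_acl]
    refine acl_le_acl (Set.union_subset ((Set.subset_insert _ _).trans (subset_acl _)) ?_) hx
    rintro _ ⟨j, rfl⟩
    have hmem : h ∈ acl k (insert h (Set.range i)) := subset_acl _ (Set.mem_insert _ _)
    rw [Subsingleton.elim j 0]
    rcases hh with hh | hh
    · simpa [← hh] using hmem
    · simpa [← hh] using inv_mem hmem
  refine ⟨acl k (Set.range i), isRelClosed_acl _, fun x hx => mem_of_mem_acl hadj hx, ?_⟩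
  rcases ht0 with h | h
  · exact ⟨_, h, hspan _ (Or.inl rfl)⟩
  · exact ⟨_, h, hspan _ (Or.inr (inv_inv _))⟩

end DiscreteValuationRings

/-! ### Homogeneity for embeddings of finite transcendence degree. -/

section Homogeneity

universe u

/-- The finite transcendence degree of `L` can be cancelled from the cardinal sums, so `K₁` and `K₂`
have equal degree over `L`. -/
theorem IsAlgClosed.exists_ringEquiv_of_finTrdeg {k L : Type*} {K₁ K₂ : Type u} [Field k]
    [Field L] [Field K₁] [Field K₂] [Algebra k L] [Algebra L K₁] [Algebra L K₂] [Algebra k K₁]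
    [Algebra k K₂] [IsScalarTower k L K₁] [IsScalarTower k L K₂] [IsAlgClosed K₁] [IsAlgClosed K₂]
    [FinTrdeg k L] (h : Algebra.trdeg k K₁ = Algebra.trdeg k K₂) :
    ∃ σ : K₁ ≃+* K₂, ∀ x : L, σ (algebraMap L K₁ x) = algebraMap L K₂ x := by
  have h1 := lift_trdeg_add_eq k L K₁
  rw [h, ← lift_trdeg_add_eq k L K₂] at h1
  have h2 := Cardinal.lift_injective (Cardinal.eq_of_add_eq_add_left h1
    (Cardinal.lift_lt_aleph0.2 (trdeg_lt_aleph0 k L)))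
  obtain ⟨s, hs⟩ := exists_isTranscendenceBasis L K₁
  obtain ⟨t, ht⟩ := exists_isTranscendenceBasis L K₂
  rw [← hs.cardinalMk_eq_trdeg, ← ht.cardinalMk_eq_trdeg] at h2
  obtain ⟨e⟩ := Cardinal.eq.1 h2
  obtain ⟨σ, -⟩ := exists_ringEquiv_of_isTranscendenceBasis e hs ht
  exact ⟨σ.toRingEquiv, σ.commutes⟩

theorem AlgHom.exists_algEquiv_comp_eq {k F L : Type*} [Field k] [Field F] [Algebra k F]
    [IsAlgClosed F] [Field L] [Algebra k L] [FinTrdeg k L] (ξ η : L →ₐ[k] F) :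
    ∃ σ : F ≃ₐ[k] F, (σ : F →ₐ[k] F).comp ξ = η := by
  obtain ⟨σ, hσ⟩ := @IsAlgClosed.exists_ringEquiv_of_finTrdeg k L F F _ _ _ _ _ ξ.toRingHom.toAlgebra
    η.toRingHom.toAlgebra _ _ (let _ := ξ.toRingHom.toAlgebra; IsScalarTower.of_algebraMap_eq' ξ.comp_algebraMap.symm)
    (let _ := η.toRingHom.toAlgebra; IsScalarTower.of_algebraMap_eq' η.comp_algebraMap.symm) _ _ _ rfl
  have hcomm : ∀ x, σ (ξ x) = η x := hσ
  refine ⟨AlgEquiv.ofRingEquiv (f := σ) fun a => ?_, AlgHom.ext hcomm⟩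
  rw [← ξ.commutes a, hcomm, η.commutes, ξ.commutes]

end Homogeneity

/-! ### Moving roots of `1 + t`: the decomposition group is not open. -/

section RootsOfUnits

open Polynomial

variable {k F : Type*} [Field k] [Field F] [Algebra k F]

/-- A `p`-th root `r / s` of `1 + t` would give `r ^ p = (1 + X) s ^ p`, and comparing degrees would
make `p` divide `1`. -/
theorem Transcendental.irreducible_X_pow_sub_C_one_add {E : Type*} [Field E] [Algebra E F] {t : F}
    (ht : Transcendental E t) {p : ℕ} (hp : p.Prime) :
    Irreducible (X ^ p - C (1 + IntermediateField.AdjoinSimple.gen E t)) := by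
  refine X_pow_sub_C_irreducible_of_prime hp fun b hb => ?_
  obtain ⟨r, s, hrs⟩ := IntermediateField.mem_adjoin_simple_iff E (b : F) |>.1 b.2
  have hb' : (b : F) ^ p = 1 + t := congrArg Subtype.val hb
  have hX : (1 + X : E[X]) ≠ 0 := by
    rw [← C_1, add_comm]
    exact X_add_C_ne_zero 1
  have ht1 : 1 + t ≠ 0 := fun h => ht ⟨1 + X, hX, by simpa using h⟩
  have hs : Polynomial.aeval t s ≠ 0 := fun h => by
    rw [hrs, h, div_zero, zero_pow hp.ne_zero] at hb'
    exact ht1 hb'.symm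
  have hs0 : s ≠ 0 := by rintro rfl; simp at hs
  have heq : r ^ p = (1 + X) * s ^ p := by
    refine transcendental_iff_injective.1 ht ?_
    rw [hrs, div_pow, div_eq_iff (pow_ne_zero _ hs)] at hb'
    simpa using hb'
  have hdeg := congrArg natDegree heq
  have h1 : (1 + X : E[X]).natDegree = 1 := by
    rw [← C_1, add_comm, natDegree_X_add_C]
  rw [natDegree_pow, natDegree_mul hX (pow_ne_zero _ hs0), h1, natDegree_pow] at hdeg
  have : p ∣ 1 := (Nat.dvd_add_left (dvd_mul_right p _)).1 (hdeg ▸ dvd_mul_right p _)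
  exact hp.one_lt.ne' (Nat.dvd_one.1 this)

variable [IsAlgClosed F]

/-- Take `N = [K(S) : K]`. An element of degree `p > N` is not in `K(S)`, hence is moved by the
Galois group over `K(S)`. -/
theorem exists_forall_irreducible_exists_algEquiv_apply_ne {K F : Type*} [Field K] [CharZero K]
    [Field F] [IsAlgClosed F] [Algebra K F] [Algebra.IsAlgebraic K F] (S : Finset F) :
    ∃ N, ∀ p, N < p → ∀ (a : K) (u : F), Irreducible (X ^ p - C a) → u ^ p = algebraMap K F a →
      ∃ τ : F ≃ₐ[K] F, (∀ x ∈ S, τ x = x) ∧ τ u ≠ u := by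
  set M := IntermediateField.adjoin K (S : Set F)
  have : FiniteDimensional K M :=
    IntermediateField.finiteDimensional_adjoin fun x _ =>
      (Algebra.IsAlgebraic.isAlgebraic (R := K) x).isIntegral
  refine ⟨Module.finrank K M, fun p hpM a u hirr hu => ?_⟩
  have hp : p ≠ 0 := (Nat.zero_le _ |>.trans_lt hpM).ne'
  have huM : u ∉ M := fun huM => by
    have hmin : X ^ p - C a = minpoly K u :=
      minpoly.eq_of_irreducible_of_monic hirr (by simp [hu]) (monic_X_pow_sub_C _ hp)
    have h1 := minpoly.natDegree_le (A := K) (⟨u, huM⟩ : M)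
    rw [← minpoly.algebraMap_eq (algebraMap M F).injective] at h1
    change (minpoly K u).natDegree ≤ _ at h1
    rw [← hmin, natDegree_X_pow_sub_C] at h1
    exact h1.not_gt hpM
  have : CharZero M := charZero_of_injective_algebraMap (algebraMap K M).injective
  have : IsAlgClosure M F := ⟨inferInstance, inferInstance⟩
  have : IsGalois M F := inferInstance
  by_contra! hall
  obtain ⟨m, hm⟩ := (InfiniteGalois.mem_range_algebraMap_iff_fixed (k := M) u).2 fun τ =>
    hall (τ.restrictScalars K) fun x hx =>
      τ.commutes ⟨x, IntermediateField.subset_adjoin _ _ hx⟩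
  exact huM (hm ▸ m.2)

open ValuationSubring in
theorem IsCoeffField.exists_pow_eq_one_add {O : ValuationSubring F} {E : IntermediateField k F}
    (hE : IsCoeffField O E) {t : F} (ht : O.valuation t < 1) {p : ℕ} (hp : p ≠ 0) :
    ∃ u, u ^ p = 1 + t ∧ O.valuation (u - 1) < 1 := by
  obtain ⟨w, hw⟩ := IsAlgClosed.exists_pow_nat_eq (1 + t) (Nat.pos_of_ne_zero hp)
  have hwO : w ∈ O := by
    have : w ^ p ∈ O := hw ▸ O.add_mem _ _ O.one_mem (mem_of_valuation_lt_one ht)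
    rw [← O.valuation_le_one_iff, map_pow] at this
    rw [← O.valuation_le_one_iff]
    exact (pow_le_one_iff hp).1 this
  obtain ⟨e, he, hwe⟩ := hE.exists_valuation_sub_lt_one hwO
  have hep : e ^ p = 1 := by
    by_contra hne
    have h1 := valuation_eq_one_of_mem_field hE.mem_of_mem (sub_mem (pow_mem he p) E.one_mem)
      (sub_ne_zero.2 hne)
    obtain ⟨c, hc⟩ := sub_dvd_pow_sub_pow (⟨w, hwO⟩ : O) ⟨e, hE.mem_of_mem e he⟩ p
    have h2 : e ^ p - 1 = t - (w - e) * c := by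
      have := congrArg Subtype.val hc
      change w ^ p - e ^ p = (w - e) * c at this
      linear_combination hw - this
    rw [h2] at h1
    refine (Valuation.map_sub_lt _ ht ?_).ne h1
    rw [map_mul]
    exact mul_lt_one_of_lt_of_le hwe ((O.valuation_le_one_iff _).2 c.2)
  have he0 : e ≠ 0 := by rintro rfl; simp [hp] at hep
  refine ⟨w / e, by rw [div_pow, hep, div_one, hw], ?_⟩
  rw [← div_self he0, ← sub_div, map_div₀, valuation_eq_one_of_mem_field hE.mem_of_mem he he0,
    div_one]
  exact hwe

variable [CharZero k]

-- Let `u ≡ 1` be a root of `1 + t` of large prime order, moved by some `τ` over `E(t)` fixing `S`.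
-- Then `τ u = ζ u` with `ζ ≠ 1` in `E`, so `ζ - 1` is a unit, whereas preserving `O` would force `τ
-- u ≡ 1`.
open ValuationSubring Pointwise in
theorem IsCoeffField.exists_notMem_decompositionSubgroup {O : ValuationSubring F}
    {E : IntermediateField k F} (hE : IsCoeffField O E) (S : Finset F) :
    ∃ τ : F ≃ₐ[k] F, (∀ x ∈ S, τ x = x) ∧ τ ∉ O.decompositionSubgroup k := by
  obtain ⟨h, hh, hspan⟩ := hE.exists_spanning
  have hhE : h ∉ E := fun h' => hh (hE.mem_of_mem h h')
  set t := h⁻¹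
  have ht : O.valuation t < 1 := valuation_inv_lt_one hh
  have htE : t ∉ E := fun h' => hhE (inv_mem_iff.1 h')
  have ht0 : t ≠ 0 := fun h0 => htE (h0 ▸ E.zero_mem)
  have htr := hE.isRelClosed.notMem_iff_transcendental.1 htE
  set K := IntermediateField.adjoin E {t}
  have : Algebra.IsAlgebraic K F := ⟨fun x =>
    mem_acl.1 (mem_acl_insert_iff.1 (hE.mem_acl_insert htE x))⟩
  have : CharZero E := charZero_of_injective_algebraMap (algebraMap k E).injective
  have : CharZero K := charZero_of_injective_algebraMap (algebraMap E K).injective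
  obtain ⟨N, hN⟩ := exists_forall_irreducible_exists_algEquiv_apply_ne (K := K) S
  obtain ⟨p, hpN, hp⟩ := Nat.exists_infinite_primes (N + 1)
  obtain ⟨u, hu, hu1⟩ := hE.exists_pow_eq_one_add ht hp.ne_zero
  obtain ⟨τ, hτS, hτ⟩ := hN p hpN _ u (htr.irreducible_X_pow_sub_C_one_add hp) (by
    rw [hu, map_add, map_one, IntermediateField.AdjoinSimple.algebraMap_gen])
  let τ' : F ≃ₐ[k] F := (τ.restrictScalars E).restrictScalars k
  refine ⟨τ', hτS, fun hdec => ?_⟩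
  have hτO : ∀ x, τ x ∈ O → x ∈ O := fun x hx => by
    have : τ' • O = O := hdec
    rw [← this, mem_smul_iff] at hx
    exact (τ.symm_apply_apply x) ▸ hx
  have hu0 : u - 1 ≠ 0 := fun h0 => ht0 (by
    rw [sub_eq_zero.1 h0, one_pow] at hu
    simpa using hu)
  have hτu1 : O.valuation (τ u - 1) < 1 := by
    have h1 : τ (u - 1)⁻¹ ∉ O := fun h' => inv_notMem_of_valuation_lt_one hu0 hu1 (hτO _ h')
    have h2 := valuation_inv_lt_one h1
    rwa [← map_inv₀ τ, inv_inv, map_sub, map_one] at h2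
  have hvu : O.valuation u = 1 := by
    rw [← sub_add_cancel u 1, Valuation.map_add_eq_of_lt_right _ (by rwa [map_one]), map_one]
  have hu0' : u ≠ 0 := by rintro rfl; simp at hvu
  have hζp : (τ u / u) ^ p = 1 := by
    have h3 : τ (1 + t) = 1 + t :=
      τ.commutes (1 + IntermediateField.AdjoinSimple.gen E t)
    rw [div_pow, ← map_pow, hu, h3, ← hu, div_self (pow_ne_zero _ hu0')]
  have hζE : τ u / u ∈ E := hE.isRelClosed _ ⟨X ^ p - C 1, X_pow_sub_C_ne_zero hp.pos 1, by simp [hζp]⟩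
  have h4 := valuation_eq_one_of_mem_field hE.mem_of_mem (sub_mem hζE E.one_mem)
    (sub_ne_zero.2 fun h5 => hτ ((div_eq_one_iff_eq hu0').1 h5))
  rw [div_sub_one hu0', map_div₀, hvu, div_one, ← sub_sub_sub_cancel_right _ _ 1] at h4
  exact (Valuation.map_sub_lt _ hτu1 hu1).ne h4

end RootsOfUnits

/-! ### Closedness, density and maximality. -/

section AutomorphismTopology

open Pointwise

variable {k F : Type*} [Field k] [Field F] [Algebra k F]

theorem dense_autTopology_iff {s : Set (F ≃ₐ[k] F)} :
    @Dense (F ≃ₐ[k] F) (autTopology k F) s ↔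
      ∀ (σ : F ≃ₐ[k] F) (S : Finset F), ∃ g ∈ s, ∀ x ∈ S, g x = σ x := by
  classical
  let := autTopology k F
  rw [dense_iff_inter_open]
  refine ⟨fun h σ S => ?_, fun h U hU ⟨σ, hσ⟩ => ?_⟩
  · obtain ⟨g, hg, hgs⟩ := h {g | ∀ x ∈ S, g x = σ x}
      (fun g hg => ⟨S, fun τ hτ x hx => (hτ x hx).trans (hg x hx)⟩) ⟨σ, fun _ _ => rfl⟩
    exact ⟨g, hgs, hg⟩
  · obtain ⟨S, hS⟩ := hU σ hσ
    obtain ⟨g, hgs, hg⟩ := h σ S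
    exact ⟨g, hS g hg, hgs⟩

theorem isClosed_decompositionSubgroup (O : ValuationSubring F) :
    IsClosed[autTopology k F] (O.decompositionSubgroup k : Set (F ≃ₐ[k] F)) := by
  let := autTopology k F
  refine ⟨fun σ hσ => ?_⟩
  have h1 : ∃ x, ¬ (x ∈ σ • O ↔ x ∈ O) := by
    by_contra! h
    exact hσ (SetLike.ext h)
  obtain ⟨x, hx⟩ := h1
  refine ⟨{σ.symm x}, fun τ hτ hdec => hx ?_⟩
  have h2 : τ.symm x = σ.symm x := by
    rw [AlgEquiv.symm_apply_eq, hτ _ (Finset.mem_singleton_self _), AlgEquiv.apply_symm_apply]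
  have h3 : τ • O = O := hdec
  rw [ValuationSubring.mem_smul_iff, ← h2, ← ValuationSubring.mem_smul_iff, h3]

variable [IsAlgClosed F]

/-- Some automorphism takes `ξ` to `η`. Density replaces it by an element of `H` agreeing with it on
the images of finitely many generators. -/
theorem exists_mem_comp_eq_of_dense {H : Subgroup (F ≃ₐ[k] F)}
    (hH : @Dense (F ≃ₐ[k] F) (autTopology k F) (H : Set (F ≃ₐ[k] F))) {L : Type*} [Field L]
    [Algebra k L] (hL : (⊤ : IntermediateField k L).FG) (ξ η : L →ₐ[k] F) :
    ∃ σ ∈ H, (σ : F →ₐ[k] F).comp ξ = η := by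
  classical
  have : Algebra.EssFiniteType k L := IntermediateField.fg_top_iff.1 hL
  obtain ⟨σ, hσ⟩ := AlgHom.exists_algEquiv_comp_eq ξ η
  obtain ⟨S, hS⟩ := hL
  obtain ⟨g, hgH, hg⟩ := dense_autTopology_iff.1 hH σ (S.image ξ)
  refine ⟨g, hgH, ?_⟩
  rw [← hσ]
  refine AlgHom.ext fun x => ?_
  have hx : x ∈ IntermediateField.adjoin k (S : Set L) := hS ▸ trivial
  induction hx using IntermediateField.adjoin_induction with
  | mem x hx => exact hg (ξ x) (Finset.mem_image_of_mem ξ hx)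
  | algebraMap x => simp
  | add x y _ _ hx hy => rw [map_add, map_add, hx, hy]
  | inv x _ hx => rw [map_inv₀, map_inv₀, hx]
  | mul x y _ _ hx hy => rw [map_mul, map_mul, hx, hy]

variable [CharZero k]

theorem IsCoeffField.dense_sup {O O' : ValuationSubring F} {E E' : IntermediateField k F}
    (hE : IsCoeffField O E) (hE' : IsCoeffField O' E') (hne : O ≠ O') :
    @Dense (F ≃ₐ[k] F) (autTopology k F)
      ((O.decompositionSubgroup k ⊔ O'.decompositionSubgroup k : Subgroup (F ≃ₐ[k] F)) :
        Set (F ≃ₐ[k] F)) :=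
  dense_autTopology_iff.2 (hE.exists_mem_sup_apply_eq hE' hne)

theorem IsCoeffField.not_isOpen_decompositionSubgroup {O : ValuationSubring F}
    {E : IntermediateField k F} (hE : IsCoeffField O E) :
    ¬ IsOpen[autTopology k F] (O.decompositionSubgroup k : Set (F ≃ₐ[k] F)) := fun hopen => by
  obtain ⟨S, hS⟩ := hopen 1 (one_mem _)
  obtain ⟨τ, hτS, hτ⟩ := hE.exists_notMem_decompositionSubgroup S
  exact hτ (hS τ hτS)

theorem IsCoeffField.maximal_decompositionSubgroup {O : ValuationSubring F}
    {E : IntermediateField k F} (hE : IsCoeffField O E) :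
    Maximal (fun U : Subgroup (F ≃ₐ[k] F) =>
      IsClosed[autTopology k F] (U : Set (F ≃ₐ[k] F)) ∧ U ≠ ⊤) (O.decompositionSubgroup k) := by
  refine ⟨⟨isClosed_decompositionSubgroup O, fun htop => ?_⟩, fun U ⟨hUc, hU⟩ hle σ hσ => ?_⟩
  · refine hE.not_isOpen_decompositionSubgroup ?_
    rw [htop, Subgroup.coe_top]
    exact (autTopology k F).isOpen_univ
  by_contra hcon
  -- For `σ ∈ U` not stabilizing `O`, the conjugate by `σ` of the decomposition group of `O` is that
  -- of `σ • O ≠ O`. So `U` contains a dense subgroup.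
  have hle' : O.decompositionSubgroup k ⊔ (σ • O).decompositionSubgroup k ≤ U := by
    refine sup_le hle fun τ hτ => ?_
    have h1 : σ⁻¹ * τ * σ ∈ O.decompositionSubgroup k := by
      have hτ' : τ • σ • O = σ • O := hτ
      rw [ValuationSubring.decompositionSubgroup, MulAction.mem_stabilizer_iff, mul_smul, mul_smul,
        hτ', inv_smul_smul]
    have h2 := U.mul_mem (U.mul_mem hσ (hle h1)) (U.inv_mem hσ)
    rwa [mul_assoc, mul_assoc, mul_assoc, mul_inv_cancel, mul_one, mul_inv_cancel_left] at h2
  let := autTopology k F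
  have hdense : Dense (U : Set (F ≃ₐ[k] F)) :=
    (hE.dense_sup (hE.smul σ) fun h => hcon h.symm).mono hle'
  exact hU (SetLike.coe_injective (hUc.closure_eq.symm.trans hdense.closure_eq))

end AutomorphismTopology

theorem mainTheorem9 {k : Type*} {F : Type*} [Field k] [Field F] [Algebra k F]
    [CharZero k] [IsAlgClosed k] [IsAlgClosed F]
    (hpos : 1 ≤ Algebra.trdeg k F) (hcount : Algebra.trdeg k F ≤ Cardinal.aleph0) :
    (∀ v ∈ discreteValuationRings k F 1, ∀ v' ∈ discreteValuationRings k F 1, v ≠ v' →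
      (∀ (L : Type*) [Field L] [Algebra k L], (⊤ : IntermediateField k L).FG →
        ∀ ξ η : L →ₐ[k] F,
          ∃ σ ∈ v.decompositionSubgroup k ⊔ v'.decompositionSubgroup k,
            (σ : F →ₐ[k] F).comp ξ = η) ∧
      @Dense (F ≃ₐ[k] F) (autTopology k F)
        ((v.decompositionSubgroup k ⊔ v'.decompositionSubgroup k :
          Subgroup (F ≃ₐ[k] F)) : Set (F ≃ₐ[k] F))) ∧
    (∀ v ∈ discreteValuationRings k F 1,
      ¬ IsOpen[autTopology k F] (v.decompositionSubgroup k : Set (F ≃ₐ[k] F)) ∧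
      Maximal (fun U : Subgroup (F ≃ₐ[k] F) =>
          IsClosed[autTopology k F] (U : Set (F ≃ₐ[k] F)) ∧ U ≠ ⊤)
        (v.decompositionSubgroup k)) := by
  refine ⟨fun v hv v' hv' hne => ?_, fun v hv => ?_⟩
  · obtain ⟨E, hE⟩ := exists_isCoeffField_of_mem_discreteValuationRings hv
    obtain ⟨E', hE'⟩ := exists_isCoeffField_of_mem_discreteValuationRings hv'
    have hdense := hE.dense_sup hE' hne
    exact ⟨fun L _ _ hL ξ η => exists_mem_comp_eq_of_dense hdense hL ξ η, hdense⟩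
  · obtain ⟨E, hE⟩ := exists_isCoeffField_of_mem_discreteValuationRings hv
    exact ⟨hE.not_isOpen_decompositionSubgroup, hE.maximal_decompositionSubgroup⟩
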